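/- **Setting.** Let $d\in\{2,3\}$, let $\Omega\subset\mathbb R^d$ be a nonempty bounded open convex polygonal/polyhedral domain, $I=(0,1)$, $u_0,u_d\in H^1_0(\Omega)$, $\delta_0>0$ and $q_a<q_b$ real. The control operator $B\colon L^2(\omega)\to L^2(\Omega)$ is one of the following: (i) $\omega\subseteq\Omega$ is measurable, with Lebesgue measure (in particular, $\omega$ may be any polygonal or polyhedral subset), and $B$ is the extension by zero; (ii) $\omega=\{1,\dots,N_c\}$ with the counting measure and $Bq=\sum_{n=1}^{N_c}q_ne_n$ with given $e_n\in L^2(\Omega)$. Let $Q_{ad}(0,1)=\{q\in L^2(I\times\omega): q_a\le q\le q_b \text{ a.e.}\}$, let $W(0,1)=H^1(I;H^{-1}(\Omega))\cap L^2(I;H^1_0(\Omega))$, and let $\Delta\colon H^1_0(\Omega)\to H^{-1}(\Omega)$ be the weak Dirichlet Laplacian. For $\nu>0$ and $q\in L^2(I\times\omega)$ let $u=S(\nu,q)\in W(0,1)$ be the solution of $\partial_tu-\nu\Delta u=\nu Bq$, $u(0)=u_0$, and put $$G(v)=\tfrac12\|v-u_d\|_{L^2(\Omega)}^2-\tfrac{\delta_0^2}{2},\qquad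 g(\nu,q)=G\big(S(\nu,q)(1)\big).$$ A pair $(\nu,q)$ is *admissible* if $\nu>0$, $q\in Q_{ad}(0,1)$ and $g(\nu,q)\le0$. The transformed time-optimal problem $(\hat P)$ is to minimize $\nu$ over all admissible $(\nu,q)$. **Theorem.** Let $\bar\nu>0$ and $\bar q\in Q_{ad}(0,1)$ satisfy the first order optimality conditions with state $\bar u=S(\bar\nu,\bar q)$, multiplier $\bar\mu>0$ and adjoint state $\bar z\in W(0,1)$, i.e. $-\partial_t\bar z-\bar\nu\Delta\bar z=0$, $\bar z(1)=\bar\mu(\bar u(1)-u_d)$, and $$\int_0^1 1+\langle B\bar q(t)+\Delta\bar u(t),\bar z(t)\rangle\,dt=0,\qquad \int_0^1\langle B^*\bar z(t),q(t)-\bar q(t)\rangle_{L^2(\omega)}\,dt\ge0\ \ \text{for all } q\in Q_{ad}(0,1),\qquad G(\bar u(1))=0 .$$ Suppose moreover that the nodal set condition $|\{(t,x)\in I\times\omega:(B^*\bar z)(t,x)=0\}|=0$ holds. Then $(\bar\nu,\bar q)$ is locally optimal for $(\hat P)$: it is admissible, and there is $\delta>0$ such that $\bar\nu\le\nu$ for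 all admissible $(\nu,q)$ with $|\nu-\bar\nu|\le\delta$ (with no restriction on $q$). Furthermore, there exists a concave, continuous, strictly increasing function $\Psi\colon[0,\infty)\to[0,\infty)$ with $\Psi(0)=0$, $\lim_{\varepsilon\to\infty}\Psi(\varepsilon)=\infty$ and $$|\{(t,x)\in I\times\omega:-\varepsilon\le(B^*\bar z)(t,x)\le\varepsilon\}|\le\Psi(\varepsilon)\quad\text{for all }\varepsilon>0,$$ and for every such $\Psi$, with inverse $\Psi^{-1}\colon[0,\infty)\to[0,\infty)$ and $c_0=\frac1{2(q_b-q_a)}$, there is $\delta>0$ such that $$\frac{\bar\nu}{6}\,\Psi^{-1}\big(c_0\|q-\bar q\|_{L^1(I\times\omega)}\big)\,\|q-\bar q\|_{L^1(I\times\omega)}\le\nu-\bar\nu$$ for all admissible $(\nu,q)$ with $|\nu-\bar\nu|\le\delta$. -/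

import Mathlib

open MeasureTheory Set Filter
open scoped InnerProductSpace

noncomputable section

namespace TimeOptimal

/-- The ambient Euclidean space `ℝ^d`. -/
abbrev Sp (d : ℕ) : Type := EuclideanSpace ℝ (Fin d)

/-- A bounded open convex polytope (convex polygonal or polyhedral domain). -/
def IsConvexPolytopalDomain {d : ℕ} (Ω : Set (Sp d)) : Prop :=
  Ω.Nonempty ∧ ∃ s : Finset (Sp d), Ω = interior (convexHull ℝ (s : Set (Sp d)))

/-- `L²(Ω)`. -/
abbrev L2 {d : ℕ} (Ω : Set (Sp d)) : Type := Lp ℝ 2 (volume.restrict Ω)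

/-- `L²(Ω; ℝ^d)`. -/
abbrev L2Vec {d : ℕ} (Ω : Set (Sp d)) : Type := Lp (Sp d) 2 (volume.restrict Ω)

open scoped ContDiff in
/-- `H¹₀(Ω)`: the closure of `{(φ, ∇φ) : φ ∈ C_c^∞(Ω)}` in `L²(Ω) × L²(Ω; ℝ^d)` with the Hilbert
product norm, i.e. the closure of the test functions in the `H¹` norm; an element is stored as the
pair of the function and its weak gradient. (The pairs `(φ, ∇φ)` already form a subspace, so
that `span` adds nothing.) -/
def H10 {d : ℕ} (Ω : Set (Sp d)) : Submodule ℝ (WithLp 2 (L2 Ω × L2Vec Ω)) :=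
  (Submodule.span ℝ {w : WithLp 2 (L2 Ω × L2Vec Ω) | ∃ φ : Sp d → ℝ,
    ContDiff ℝ ∞ φ ∧ HasCompactSupport φ ∧ tsupport φ ⊆ Ω ∧
    w.fst =ᵐ[volume.restrict Ω] φ ∧
    w.snd =ᵐ[volume.restrict Ω] gradient φ}).topologicalClosure

/-- The embedding `H¹₀(Ω) → L²(Ω)`. -/
def toL2 {d : ℕ} (Ω : Set (Sp d)) : H10 Ω →L[ℝ] L2 Ω :=
  (WithLp.fstL 2 ℝ (L2 Ω) (L2Vec Ω)).comp (H10 Ω).subtypeL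

/-- The weak gradient `H¹₀(Ω) → L²(Ω; ℝ^d)`. -/
def grad {d : ℕ} (Ω : Set (Sp d)) : H10 Ω →L[ℝ] L2Vec Ω :=
  (WithLp.sndL 2 ℝ (L2 Ω) (L2Vec Ω)).comp (H10 Ω).subtypeL

/-- `H⁻¹(Ω)`, the dual of `H¹₀(Ω)`; the duality pairing is evaluation. -/
abbrev Hm1 {d : ℕ} (Ω : Set (Sp d)) : Type := StrongDual ℝ (H10 Ω)

/-- The embedding `L²(Ω) → H⁻¹(Ω)`, `f ↦ (φ ↦ (f, φ)_{L²})`. -/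
def emb {d : ℕ} (Ω : Set (Sp d)) (f : L2 Ω) : Hm1 Ω :=
  (innerSL ℝ f).comp (toL2 Ω)

/-- The Dirichlet Laplacian `Δ : H¹₀(Ω) → H⁻¹(Ω)`, `⟨Δ u, φ⟩ = -(∇u, ∇φ)_{L²}`. -/
def lap {d : ℕ} (Ω : Set (Sp d)) (u : H10 Ω) : Hm1 Ω :=
  -(innerSL ℝ (grad Ω u)).comp (grad Ω)

/-- Lebesgue measure on the reference time interval `I = (0,1)`. -/
def timeMeasure : Measure ℝ := volume.restrict (Ioo (0 : ℝ) 1)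

/-- `W(0,1) = H¹(I; H⁻¹(Ω)) ∩ L²(I; H¹₀(Ω))`. An element is given by its class `val` in
`L²(I; H¹₀)`, its weak time derivative `dt` in `L²(I; H⁻¹)` and its representative `path` in
`C([0,1]; L²(Ω))`, whose values are the traces `u(t)`; values of `path` outside `[0,1]` are
irrelevant. That `dt` is the weak derivative is expressed by the fundamental theorem of calculus
in `H⁻¹(Ω)`. -/
structure W {d : ℕ} (Ω : Set (Sp d)) where
  val : Lp (H10 Ω) 2 timeMeasure
  dt : Lp (Hm1 Ω) 2 timeMeasure
  path : ℝ → L2 Ω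
  path_continuousOn : ContinuousOn path (Icc 0 1)
  path_ae : ∀ᵐ t ∂timeMeasure, toL2 Ω (val t) = path t
  path_primitive : ∀ t ∈ Icc (0 : ℝ) 1,
    emb Ω (path t) = emb Ω (path 0) + ∫ s in (0 : ℝ)..t, dt s

/-- The control spaces `L²(ω) = L²(X, ρ)` and control operators `B : L²(ω) → L²(Ω)` considered:
* distributed control on a measurable `ω ⊆ Ω` with Lebesgue measure, `B` the extension by zero;
* purely time-dependent control, `ω = {1,…,N}` with counting measure, `B q = ∑ n, q_n e_n`. -/
inductive IsControlOperator {d : ℕ} (Ω : Set (Sp d)) :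
    (X : Type) → [MeasurableSpace X] → (ρ : Measure X) → (Lp ℝ 2 ρ →L[ℝ] L2 Ω) → Prop
  | distributed (ω : Set (Sp d)) (hω : MeasurableSet ω) (hsub : ω ⊆ Ω)
      (B : Lp ℝ 2 (volume.restrict ω) →L[ℝ] L2 Ω)
      (hB : ∀ q : Lp ℝ 2 (volume.restrict ω),
        B q =ᵐ[volume.restrict Ω] ω.indicator q) :
      IsControlOperator Ω (Sp d) (volume.restrict ω) B
  | timeDependent (N : ℕ) (e : Fin N → L2 Ω)
      (B : Lp ℝ 2 (Measure.count : Measure (Fin N)) →L[ℝ] L2 Ω)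
      (hB : ∀ q : Lp ℝ 2 (Measure.count : Measure (Fin N)), B q = ∑ n, q n • e n) :
      IsControlOperator Ω (Fin N) Measure.count B

section Control

variable {X : Type} [MeasurableSpace X] (ρ : Measure X)

/-- The measure on `I × ω`. -/
def stMeasure : Measure (ℝ × X) := timeMeasure.prod ρ

/-- `Q(0,1) = L²(I × ω)`. -/
abbrev Q : Type := Lp ℝ 2 (stMeasure ρ)

variable {ρ}

open Classical in
/-- The time slice `q(t) = q(t, ·) ∈ L²(ω)`; for almost every `t` the slice is square integrable,
at the exceptional `t` the value is `0`. -/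
def slice (q : Q ρ) (t : ℝ) : Lp ℝ 2 ρ :=
  if h : MemLp (fun x => q (t, x)) 2 ρ then h.toLp _ else 0

variable (ρ) in
/-- `Q_ad(0,1)`: the controls with `q_a ≤ q ≤ q_b` almost everywhere in `I × ω`. -/
def Qad (qa qb : ℝ) : Set (Q ρ) :=
  {q | ∀ᵐ y ∂(stMeasure ρ), qa ≤ q y ∧ q y ≤ qb}

variable {d : ℕ} {Ω : Set (Sp d)} (B : Lp ℝ 2 ρ →L[ℝ] L2 Ω)

/-- `u = S(ν, q)`: `u ∈ W(0,1)` solves `∂ₜu - ν Δu = ν B q` in `L²(I; H⁻¹)`, `u(0) = u₀`. -/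
def IsState (u₀ : H10 Ω) (ν : ℝ) (q : Q ρ) (u : W Ω) : Prop :=
  u.path 0 = toL2 Ω u₀ ∧
  ∀ᵐ t ∂timeMeasure, u.dt t - ν • lap Ω (u.val t) = ν • emb Ω (B (slice q t))

/-- The terminal constraint `G(v) = ½‖v - u_d‖² - δ₀²/2`. -/
def G (ud : H10 Ω) (δ₀ : ℝ) (v : L2 Ω) : ℝ :=
  1 / 2 * ‖v - toL2 Ω ud‖ ^ 2 - δ₀ ^ 2 / 2

/-- `(ν, q)` is admissible for the transformed problem: `ν > 0`, `q ∈ Q_ad(0,1)` and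
`g(ν, q) = G(S(ν, q)(1)) ≤ 0`. -/
def Admissible (u₀ ud : H10 Ω) (δ₀ qa qb : ℝ) (ν : ℝ) (q : Q ρ) : Prop :=
  0 < ν ∧ q ∈ Qad ρ qa qb ∧ ∃ u : W Ω, IsState B u₀ ν q u ∧ G ud δ₀ (u.path 1) ≤ 0

/-- `(ν̄, q̄)` is a (local) solution of: minimize `ν` over all admissible `(ν, q)`. The
neighbourhood restricts the time `ν` only; all controls compete. -/
def IsLocallyOptimal (u₀ ud : H10 Ω) (δ₀ qa qb : ℝ) (νb : ℝ) (qbar : Q ρ) : Prop :=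
  Admissible B u₀ ud δ₀ qa qb νb qbar ∧
  ∃ δ > 0, ∀ (ν : ℝ) (q : Q ρ), Admissible B u₀ ud δ₀ qa qb ν q → |ν - νb| ≤ δ → νb ≤ ν

/-- `-∂ₜz - ν Δz = 0` in `L²(I; H⁻¹)`, `z(1) = z₁`. -/
def IsAdjointState (ν : ℝ) (z₁ : L2 Ω) (z : W Ω) : Prop :=
  z.path 1 = z₁ ∧ ∀ᵐ t ∂timeMeasure, -z.dt t - ν • lap Ω (z.val t) = 0

/-- The first order optimality conditions at `(ν̄, q̄)` with state `ū`, multiplier `μ̄ > 0` and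
adjoint state `z̄`. -/
structure FirstOrderConditions (u₀ ud : H10 Ω) (δ₀ qa qb : ℝ) (νb : ℝ) (qbar : Q ρ)
    (ubar : W Ω) (μb : ℝ) (zbar : W Ω) : Prop where
  time_pos : 0 < νb
  control_mem : qbar ∈ Qad ρ qa qb
  state : IsState B u₀ νb qbar ubar
  multiplier_pos : 0 < μb
  adjoint : IsAdjointState νb (μb • (ubar.path 1 - toL2 Ω ud)) zbar
  hamiltonian : ∫ t in (0 : ℝ)..1,
    (1 + (emb Ω (B (slice qbar t)) + lap Ω (ubar.val t)) (zbar.val t)) = 0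
  variational : ∀ q ∈ Qad ρ qa qb,
    0 ≤ ∫ t in (0 : ℝ)..1,
      ⟪ContinuousLinearMap.adjoint B (zbar.path t), slice q t - slice qbar t⟫_ℝ
  terminal : G ud δ₀ (ubar.path 1) = 0

/-- `p ∈ L²(I × ω)` is the function `B*z`, i.e. `p(t, ·) = B*(z(t))` for almost every `t`. -/
def IsObservation (z : W Ω) (p : Q ρ) : Prop :=
  ∀ᵐ t ∂timeMeasure, slice p t = ContinuousLinearMap.adjoint B (z.path t)

end Control

/-- The structural functions for `p = B*z̄`: concave, continuous, strictly increasing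
`Ψ : [0,∞) → [0,∞)` with `Ψ(0) = 0`, `Ψ(ε) → ∞` as `ε → ∞` and
`|{-ε ≤ p ≤ ε}| ≤ Ψ(ε)` for all `ε > 0`. Values of `Ψ` on negative reals are irrelevant. -/
structure IsStructuralFunction {X : Type} [MeasurableSpace X] {ρ : Measure X} (p : Q ρ)
    (Ψ : ℝ → ℝ) : Prop where
  concave : ConcaveOn ℝ (Ici 0) Ψ
  continuousOn : ContinuousOn Ψ (Ici 0)
  strictMono : StrictMonoOn Ψ (Ici 0)
  zero : Ψ 0 = 0
  tendsto : Tendsto Ψ atTop atTop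
  measure_le : ∀ ε > 0, stMeasure ρ {y | -ε ≤ p y ∧ p y ≤ ε} ≤ ENNReal.ofReal (Ψ ε)

/-- The inverse `Ψ⁻¹ : [0,∞) → [0,∞)` of a structural function. -/
def psiInv (Ψ : ℝ → ℝ) (y : ℝ) : ℝ := Function.invFunOn Ψ (Ici 0) y

/-- `‖q₁ - q₂‖_{L¹(I × ω)}`. -/
def l1Dist {X : Type} [MeasurableSpace X] {ρ : Measure X} (q₁ q₂ : Q ρ) : ℝ :=
  ∫ y, |q₁ y - q₂ y| ∂(stMeasure ρ)

end TimeOptimal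

end

/-! The state equation is bilinear in `ν` and `(q, u)`, so testing the difference of two state
equations with the adjoint state leaves no unspecified remainder: `⟨u(1) - ū(1), z̄(1)⟩ = (ν - ν̄)(H
- 1) + ν̄ ∫⟨B*z̄, q - q̄⟩`, where `H` is `hamiltonianChange` and the `-1` is the Hamiltonian
condition (`inner_terminal`). If `G(u(1)) ≤ 0 = G(ū(1))`, convexity of `G` and `μ̄ > 0` make the
left side nonpositive, so `ν̄ ∫⟨B*z̄, q - q̄⟩ ≤ (ν - ν̄)(1 - H)` (`growth_le`).

The integral on the left grows. As `p = B*z̄` vanishes only on a null set, `q̄` is bang-bang and `p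
(q - q̄) = |p| |q - q̄|` almost everywhere. Discarding the set where `|p|` is small costs at most
half of the `L¹` distance `L` and gives the lower bound `½ Ψ⁻¹(c₀ L) L`
(`IsStructuralFunction.growth`).

On the right, the energy estimate and `‖q - q̄‖²_{L²} ≤ (q_b - q_a) L` give `|H| ≤ 1/2 + C (L + (ν -
ν̄)²)`. No smallness of `L` is assumed, but `L` is bounded on `Q_ad`, so for small `|ν - ν̄|` the
inequality itself forces `L` to be small. Then `1 - H` lies between positive constants, which gives
both `ν ≥ ν̄` and the growth rate (`exists_growth_constant`).

The analytic tool behind the identity and the energy estimate is integration by parts in `W(0,1)`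
(`IsEvolution.inner_eq`), obtained from difference quotients in time. -/

noncomputable section

namespace TimeOptimal

/-! ### Pairings of translated `L²` functions. -/

section Translation

variable {V : Type*} [NormedAddCommGroup V] [NormedSpace ℝ V]

/-- Translations act continuously on `L²`, and the pairing of `L²` functions is jointly continuous.
-/
theorem continuous_integral_pairing_translates {f : ℝ → StrongDual ℝ V} {g : ℝ → V}
    (hf : MemLp f 2 volume) (hg : MemLp g 2 volume) (S : Set ℝ) :
    Continuous fun c : ℝ × ℝ => ∫ s in S, f (c.1 + s) (g (c.2 + s)) := by
  have : Fact ((2 : ENNReal) ≠ ⊤) := ⟨by simp⟩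
  let P : Lp (StrongDual ℝ V) 2 (volume.restrict S) →L[ℝ] Lp V 2 (volume.restrict S) →L[ℝ] ℝ :=
    (ContinuousLinearMap.id ℝ (StrongDual ℝ V)).lpPairing (volume.restrict S) 2 2
  let F : ℝ → Lp (StrongDual ℝ V) 2 (volume.restrict S) := fun r =>
    LpToLpRestrictCLM ℝ (StrongDual ℝ V) ℝ volume 2 S (DomAddAct.mk r +ᵥ hf.toLp f)
  let K : ℝ → Lp V 2 (volume.restrict S) := fun r =>
    LpToLpRestrictCLM ℝ V ℝ volume 2 S (DomAddAct.mk r +ᵥ hg.toLp g)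
  have hmk : Continuous (DomAddAct.mk : ℝ → ℝᵈᵃᵃ) := DomAddAct.continuous_mk
  have hF : Continuous F :=
    (ContinuousLinearMap.continuous _).comp (hmk.vadd continuous_const)
  have hK : Continuous K :=
    (ContinuousLinearMap.continuous _).comp (hmk.vadd continuous_const)
  have hFe : ∀ r, ⇑(F r) =ᵐ[volume.restrict S] fun s => f (r + s) := fun r => by
    refine (LpToLpRestrictCLM_coeFn ℝ S _).trans (ae_restrict_of_ae ?_)
    rw [DomAddAct.mk_vadd_toLp]
    exact MemLp.coeFn_toLp _
  have hKe : ∀ r, ⇑(K r) =ᵐ[volume.restrict S] fun s => g (r + s) := fun r => by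
    refine (LpToLpRestrictCLM_coeFn ℝ S _).trans (ae_restrict_of_ae ?_)
    rw [DomAddAct.mk_vadd_toLp]
    exact MemLp.coeFn_toLp _
  have hP : (fun c : ℝ × ℝ => ∫ s in S, f (c.1 + s) (g (c.2 + s))) =
      fun c => P (F c.1) (K c.2) := by
    funext c
    rw [ContinuousLinearMap.lpPairing_eq_integral]
    refine integral_congr_ae ?_
    filter_upwards [hFe c.1, hKe c.2] with s h1 h2
    rw [h1, h2]; rfl
  rw [hP]
  exact (P.continuous.comp (hF.comp continuous_fst)).clm_apply (hK.comp continuous_snd)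

/-- Fubini; the integrand is dominated by `‖f(r + s)‖² + ‖g(c + s)‖²`, and translation invariance
bounds the integral of the first term uniformly in `r`. -/
theorem integral_pairing_swap {f : ℝ → StrongDual ℝ V} {g : ℝ → V}
    (hf : MemLp f 2 volume) (hg : MemLp g 2 volume) (S T : Set ℝ) (c : ℝ)
    [IsFiniteMeasure (volume.restrict S)] [IsFiniteMeasure (volume.restrict T)] :
    ∫ s in S, (∫ r in T, f (r + s)) (g (c + s)) =
      ∫ r in T, ∫ s in S, f (r + s) (g (c + s)) := by
  have hmp : ∀ r : ℝ, MeasurePreserving (fun s : ℝ => r + s) volume volume :=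
    fun r => measurePreserving_add_left volume r
  have hgc : MemLp (fun s => g (c + s)) 2 volume := hg.comp_measurePreserving (hmp c)
  have hfs : ∀ s : ℝ, IntegrableOn (fun r => f (r + s)) T volume := fun s =>
    ((hf.comp_measurePreserving (measurePreserving_add_right volume s)).restrict T).integrable
      one_le_two
  have h1 : ∀ s, (∫ r in T, f (r + s)) (g (c + s)) = ∫ r in T, f (r + s) (g (c + s)) := fun s =>
    ContinuousLinearMap.integral_apply (hfs s) _
  simp_rw [h1]
  refine integral_integral_swap ?_
  -- the shear `(s, r) ↦ (r, r + s)`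
  have hsh := measurePreserving_prod_add_swap (volume : Measure ℝ) (volume : Measure ℝ)
  have hq : Measure.QuasiMeasurePreserving (fun z : ℝ × ℝ => z.2 + z.1) (volume.prod volume)
      volume := Measure.quasiMeasurePreserving_snd.comp hsh.quasiMeasurePreserving
  have hfm : AEStronglyMeasurable (fun z : ℝ × ℝ => f (z.2 + z.1)) (volume.prod volume) :=
    hf.1.comp_quasiMeasurePreserving hq
  have hgm : AEStronglyMeasurable (fun z : ℝ × ℝ => g (c + z.1)) (volume.prod volume) :=
    hgc.1.comp_fst
  have hle : (volume.restrict S).prod (volume.restrict T) ≤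
      (volume : Measure (ℝ × ℝ)) := by
    rw [Measure.prod_restrict]; exact Measure.restrict_le_self
  have hfm' := hfm.mono_measure hle
  have hgm' := hgm.mono_measure hle
  have hm : AEStronglyMeasurable (fun z : ℝ × ℝ => f (z.2 + z.1) (g (c + z.1)))
      ((volume.restrict S).prod (volume.restrict T)) :=
    (ContinuousLinearMap.id ℝ (StrongDual ℝ V)).aestronglyMeasurable_comp₂ hfm' hgm'
  have hi2 : Integrable (fun z : ℝ × ℝ => ‖g (c + z.1)‖ ^ 2)
      ((volume.restrict S).prod (volume.restrict T)) := by
    have : Integrable (fun s => ‖g (c + s)‖ ^ 2) (volume.restrict S) :=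
      ((memLp_two_iff_integrable_sq_norm hgc.1).1 hgc).restrict
    exact this.comp_fst _
  have hi1 : Integrable (fun z : ℝ × ℝ => ‖f (z.2 + z.1)‖ ^ 2)
      ((volume.restrict S).prod (volume.restrict T)) := by
    have h0 : Integrable (fun s => ‖f s‖ ^ 2) volume :=
      (memLp_two_iff_integrable_sq_norm hf.1).1 hf
    have hn : AEStronglyMeasurable (fun z : ℝ × ℝ => ‖f (z.2 + z.1)‖ ^ 2)
        ((volume.restrict S).prod (volume.restrict T)) := hfm'.norm.pow 2
    rw [integrable_prod_iff' hn]
    refine ⟨Eventually.of_forall fun r => (h0.comp_add_left r).restrict, ?_⟩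
    refine (integrable_const (∫ s, ‖f s‖ ^ 2)).mono'
      hn.norm.prod_swap.integral_prod_right' (Eventually.of_forall fun r => ?_)
    rw [Real.norm_of_nonneg (integral_nonneg fun _ => norm_nonneg _)]
    simp only [norm_pow, norm_norm]
    calc ∫ s in S, ‖f (r + s)‖ ^ 2 ≤ ∫ s, ‖f (r + s)‖ ^ 2 :=
          setIntegral_le_integral (h0.comp_add_left r)
            (Eventually.of_forall fun _ => sq_nonneg _)
      _ = ∫ s, ‖f s‖ ^ 2 := integral_add_left_eq_self (fun s => ‖f s‖ ^ 2) r
  refine (hi1.add hi2).mono' hm (Eventually.of_forall fun z => ?_)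
  have := (f (z.2 + z.1)).le_opNorm (g (c + z.1))
  simp only [Function.uncurry, Pi.add_apply]
  nlinarith [sq_nonneg (‖f (z.2 + z.1)‖ - ‖g (c + z.1)‖), sq_nonneg (‖f (z.2 + z.1)‖),
    sq_nonneg (‖g (c + z.1)‖)]

end Translation

/-! ### Limits of one-sided averages. -/

theorem tendsto_average_right {φ : ℝ → ℝ → ℝ} {l : ℝ}
    (hi : ∀ᶠ h in nhdsWithin (0 : ℝ) (Ioi 0), IntervalIntegrable (φ h) volume 0 h)
    (hl : ∀ ε > 0, ∀ᶠ h in nhdsWithin (0 : ℝ) (Ioi 0), ∀ r ∈ Ioc 0 h, |φ h r - l| ≤ ε) :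
    Tendsto (fun h => h⁻¹ * ∫ r in (0 : ℝ)..h, φ h r) (nhdsWithin (0 : ℝ) (Ioi 0)) (nhds l) := by
  rw [Metric.tendsto_nhds]
  intro ε hε
  filter_upwards [hi, hl (ε / 2) (half_pos hε), self_mem_nhdsWithin] with h h1 h2 h3
  have h3 : 0 < h := h3
  have hc : ∫ r in (0 : ℝ)..h, (φ h r - l) = (∫ r in (0 : ℝ)..h, φ h r) - h * l := by
    rw [intervalIntegral.integral_sub h1 intervalIntegrable_const]; simp
  have hb : ‖∫ r in (0 : ℝ)..h, (φ h r - l)‖ ≤ ε / 2 * |h - 0| :=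
    intervalIntegral.norm_integral_le_of_norm_le_const fun r hr => by
      rw [uIoc_of_le h3.le] at hr; exact h2 r hr
  rw [hc, sub_zero, abs_of_pos h3, Real.norm_eq_abs] at hb
  rw [Real.dist_eq]
  have : h⁻¹ * (∫ r in (0 : ℝ)..h, φ h r) - l = h⁻¹ * ((∫ r in (0 : ℝ)..h, φ h r) - h * l) := by
    field_simp
  rw [this, abs_mul, abs_of_pos (inv_pos.2 h3)]
  calc h⁻¹ * |(∫ r in (0 : ℝ)..h, φ h r) - h * l| ≤ h⁻¹ * (ε / 2 * h) := by gcongr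
    _ = ε / 2 := by field_simp
    _ < ε := half_lt_self hε

/-- The shift `γ h` may depend on the window length; the two cases needed later are `γ h = h` and `γ
h = 0`. -/
theorem tendsto_average_of_continuous {K : ℝ × ℝ → ℝ} (hK : Continuous K) {γ : ℝ → ℝ}
    (hγ : Continuous γ) (h0 : γ 0 = 0) :
    Tendsto (fun h => h⁻¹ * ∫ r in (0 : ℝ)..h, K (r, γ h)) (nhdsWithin (0 : ℝ) (Ioi 0))
      (nhds (K (0, 0))) := by
  refine tendsto_average_right (φ := fun h r => K (r, γ h)) ?_ ?_
  · exact Eventually.of_forall fun h =>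
      (hK.comp (continuous_id.prodMk continuous_const)).intervalIntegrable _ _
  · intro ε hε
    have hc : Tendsto (fun c : ℝ × ℝ => K (c.1, γ c.2)) (nhds (0, 0)) (nhds (K (0, 0))) := by
      have : Continuous (fun c : ℝ × ℝ => K (c.1, γ c.2)) :=
        hK.comp (continuous_fst.prodMk (hγ.comp continuous_snd))
      simpa [h0] using this.tendsto (0, 0)
    obtain ⟨δ, hδ, hb⟩ := Metric.tendsto_nhds_nhds.1 hc ε hε
    filter_upwards [Ioo_mem_nhdsGT hδ] with h hh r hr
    refine le_of_lt (hb (x := (r, h)) ?_)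
    rw [Prod.dist_eq, max_lt_iff]
    simp only [Real.dist_eq, sub_zero]
    rw [abs_of_pos hr.1, abs_of_pos hh.1]
    exact ⟨hr.2.trans_lt hh.2, hh.2⟩

theorem tendsto_average_of_continuousOn {φ : ℝ → ℝ} (hφ : ContinuousOn φ (Icc 0 1)) {t : ℝ}
    (ht : t ∈ Ico (0 : ℝ) 1) :
    Tendsto (fun h => h⁻¹ * ∫ s in t..(t + h), φ s) (nhdsWithin (0 : ℝ) (Ioi 0))
      (nhds (φ t)) := by
  have hs : ∀ h, ∫ s in t..(t + h), φ s = ∫ r in (0 : ℝ)..h, φ (t + r) := fun h => by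
    rw [intervalIntegral.integral_comp_add_left (fun s => φ s)]; simp
  simp_rw [hs]
  refine tendsto_average_right (φ := fun _ r => φ (t + r)) ?_ ?_
  · filter_upwards [Ioo_mem_nhdsGT (sub_pos.2 ht.2)] with h hh
    refine ContinuousOn.intervalIntegrable (hφ.comp (by fun_prop) fun r hr => ?_)
    rw [uIcc_of_le hh.1.le] at hr
    constructor <;> linarith [hr.1, hr.2, hh.2, ht.1]
  · intro ε hε
    obtain ⟨δ, hδ, hb⟩ := Metric.continuousOn_iff.1 hφ t ⟨ht.1, ht.2.le⟩ ε hε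
    filter_upwards [Ioo_mem_nhdsGT (lt_min (sub_pos.2 ht.2) hδ)] with h hh r hr
    have h1 := hh.2.trans_le (min_le_left _ _)
    have h2 := hh.2.trans_le (min_le_right _ _)
    refine le_of_lt (hb (t + r) ⟨by linarith [ht.1, hr.1], by linarith [hr.2]⟩ ?_)
    rw [Real.dist_eq, add_sub_cancel_left, abs_of_pos hr.1]
    exact hr.2.trans_lt h2

/-! ### Integration by parts in `W(0,1)`. -/

section Evolution

variable {H V : Type*} [NormedAddCommGroup H] [InnerProductSpace ℝ H]
  [NormedAddCommGroup V] [NormedSpace ℝ V]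

/-- `u ∈ C([0,1]; H)` represents `U ∈ L²(I; V)`, and `f ∈ L²(I; V')` is the weak time derivative
of `u`, where `j : V → H` and `H` is mapped to `V'` by the transpose of `j`. -/
structure IsEvolution (j : V →L[ℝ] H) (u : ℝ → H) (U : ℝ → V) (f : ℝ → StrongDual ℝ V) :
    Prop where
  continuousOn : ContinuousOn u (Icc 0 1)
  memLp_val : MemLp U 2 timeMeasure
  memLp_dt : MemLp f 2 timeMeasure
  ae_eq : ∀ᵐ t ∂timeMeasure, j (U t) = u t
  primitive : ∀ t ∈ Icc (0 : ℝ) 1, ∀ φ, ⟪u t, j φ⟫_ℝ = ⟪u 0, j φ⟫_ℝ + (∫ s in (0 : ℝ)..t, f s) φ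

instance : IsFiniteMeasure timeMeasure := by unfold timeMeasure; infer_instance

theorem integral_timeMeasure {E : Type*} [NormedAddCommGroup E] [NormedSpace ℝ E] (f : ℝ → E) :
    ∫ s, f s ∂timeMeasure = ∫ s in (0 : ℝ)..1, f s := by
  rw [intervalIntegral.integral_of_le zero_le_one, integral_Ioc_eq_integral_Ioo]; rfl

theorem intervalIntegrable_of_timeMeasure {E : Type*} [NormedAddCommGroup E]
    {f : ℝ → E} (hf : Integrable f timeMeasure) {a b : ℝ} (ha : a ∈ Icc (0 : ℝ) 1)
    (hb : b ∈ Icc (0 : ℝ) 1) : IntervalIntegrable f volume a b := by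
  have h : IntegrableOn f (Icc 0 1) volume :=
    (integrableOn_Icc_iff_integrableOn_Ioo (by simp) (by simp)).2 hf
  exact (h.mono_set ((convex_Icc (0 : ℝ) 1).ordConnected.uIcc_subset ha hb)).intervalIntegrable

theorem ae_timeMeasure_iff {P : ℝ → Prop} :
    (∀ᵐ t ∂timeMeasure, P t) ↔ ∀ᵐ t, t ∈ Ioo (0 : ℝ) 1 → P t :=
  ae_restrict_iff' measurableSet_Ioo

theorem integrable_pairing {μ : Measure ℝ} {f : ℝ → StrongDual ℝ V} {g : ℝ → V}
    (hf : MemLp f 2 μ) (hg : MemLp g 2 μ) : Integrable (fun t => f t (g t)) μ := by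
  rw [← memLp_one_iff_integrable]
  exact (ContinuousLinearMap.id ℝ (StrongDual ℝ V)).memLp_of_bilin (p := 2) (q := 2) 1 hf hg

variable {j : V →L[ℝ] H} {u v : ℝ → H} {U W : ℝ → V} {f g : ℝ → StrongDual ℝ V}

theorem IsEvolution.inner_sub (hu : IsEvolution j u U f) {s t : ℝ} (hs : s ∈ Icc (0 : ℝ) 1)
    (ht : t ∈ Icc (0 : ℝ) 1) (φ : V) :
    ⟪u t - u s, j φ⟫_ℝ = (∫ r in s..t, f r) φ := by
  have h0 : (0 : ℝ) ∈ Icc (0 : ℝ) 1 := ⟨le_rfl, zero_le_one⟩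
  have hf := hu.memLp_dt.integrable one_le_two
  rw [inner_sub_left, hu.primitive t ht, hu.primitive s hs,
    ← intervalIntegral.integral_interval_sub_left (intervalIntegrable_of_timeMeasure hf h0 ht)
      (intervalIntegrable_of_timeMeasure hf h0 hs)]
  simp

theorem IsEvolution.sub (hu : IsEvolution j u U f) (hv : IsEvolution j v W g) :
    IsEvolution j (fun t => u t - v t) (fun t => U t - W t) (fun t => f t - g t) where
  continuousOn := hu.continuousOn.sub hv.continuousOn
  memLp_val := hu.memLp_val.sub hv.memLp_val
  memLp_dt := hu.memLp_dt.sub hv.memLp_dt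
  ae_eq := by
    filter_upwards [hu.ae_eq, hv.ae_eq] with t h1 h2
    rw [map_sub, h1, h2]
  primitive t ht φ := by
    have h0 : (0 : ℝ) ∈ Icc (0 : ℝ) 1 := ⟨le_rfl, zero_le_one⟩
    rw [intervalIntegral.integral_sub
      (intervalIntegrable_of_timeMeasure (hu.memLp_dt.integrable one_le_two) h0 ht)
      (intervalIntegrable_of_timeMeasure (hv.memLp_dt.integrable one_le_two) h0 ht),
      inner_sub_left, inner_sub_left, hu.primitive t ht, hv.primitive t ht]
    simp only [sub_apply]
    ring

/-- The extension by zero of a function on the time interval. -/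
def zeroExt {E : Type*} [Zero E] (k : ℝ → E) : ℝ → E := (Ioo (0 : ℝ) 1).indicator k

theorem memLp_zeroExt {E : Type*} [NormedAddCommGroup E] {k : ℝ → E}
    (hk : MemLp k 2 timeMeasure) : MemLp (zeroExt k) 2 volume :=
  (memLp_indicator_iff_restrict measurableSet_Ioo).2 hk

/-- Increments of `u` are known only when tested against the range of `j`; this suffices since `v(c
+ s) = j (W(c + s))` for almost every `s`. All times involved stay in `(0,1)`, so the zero
extensions change nothing. -/
theorem IsEvolution.ae_increment (hu : IsEvolution j u U f) (hv : IsEvolution j v W g)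
    {t h c : ℝ} (ht : t ∈ Ico (0 : ℝ) 1) (hh : h ∈ Ioo 0 (1 - t)) (hc : c ∈ Icc 0 h) :
    ∀ᵐ s, s ∈ Ioc 0 t →
      ⟪u (h + s) - u s, v (c + s)⟫_ℝ =
        (∫ r in Ioc 0 h, zeroExt f (r + s)) (zeroExt W (c + s)) := by
  have hv' : ∀ᵐ s : ℝ, c + s ∈ Ioo (0 : ℝ) 1 → j (W (c + s)) = v (c + s) :=
    (measurePreserving_add_left volume c).quasiMeasurePreserving.ae
      (ae_timeMeasure_iff.1 hv.ae_eq)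
  filter_upwards [hv'] with s hs hst
  have hcs : c + s ∈ Ioo (0 : ℝ) 1 := by
    constructor <;> linarith [hc.1, hc.2, hst.1, hst.2, hh.2]
  have h1 : s ∈ Icc (0 : ℝ) 1 := ⟨hst.1.le, by linarith [hst.2, ht.2]⟩
  have h2 : h + s ∈ Icc (0 : ℝ) 1 := by
    constructor <;> linarith [hh.1, hst.1, hst.2, hh.2]
  rw [← hs hcs, hu.inner_sub h1 h2]
  have hW : zeroExt W (c + s) = W (c + s) := indicator_of_mem hcs _
  rw [hW, ← intervalIntegral.integral_of_le hh.1.le,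
    intervalIntegral.integral_comp_add_right (fun r => zeroExt f r), zero_add]
  congr 1
  refine intervalIntegral.integral_congr_ae (Eventually.of_forall fun r hr => ?_)
  rw [uIoc_of_le (by linarith [hh.1])] at hr
  exact (indicator_of_mem (show r ∈ Ioo (0 : ℝ) 1 from
    ⟨by linarith [hr.1, hst.1], by linarith [hr.2, hh.2, hst.2]⟩) _).symm

theorem continuousOn_inner_translate (hu : ContinuousOn u (Icc 0 1))
    (hv : ContinuousOn v (Icc 0 1)) {t a b : ℝ} (ha : a ∈ Icc 0 (1 - t)) (hb : b ∈ Icc 0 (1 - t)) :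
    ContinuousOn (fun s => ⟪u (a + s), v (b + s)⟫_ℝ) (Icc 0 t) :=
  ContinuousOn.inner
    (hu.comp (by fun_prop) fun s hs => by constructor <;> linarith [hs.1, hs.2, ha.1, ha.2])
    (hv.comp (by fun_prop) fun s hs => by constructor <;> linarith [hs.1, hs.2, hb.1, hb.2])

theorem IsEvolution.integral_increment (hu : IsEvolution j u U f) (hv : IsEvolution j v W g)
    {t h c : ℝ} (ht : t ∈ Ico (0 : ℝ) 1) (hh : h ∈ Ioo 0 (1 - t)) (hc : c ∈ Icc 0 h) :
    ∫ s in (0 : ℝ)..t, ⟪u (h + s) - u s, v (c + s)⟫_ℝ =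
      ∫ r in (0 : ℝ)..h, ∫ s in Ioc 0 t, zeroExt f (r + s) (zeroExt W (c + s)) := by
  rw [intervalIntegral.integral_of_le ht.1, intervalIntegral.integral_of_le hh.1.le,
    ← integral_pairing_swap (memLp_zeroExt hu.memLp_dt) (memLp_zeroExt hv.memLp_val)]
  exact setIntegral_congr_ae measurableSet_Ioc (hu.ae_increment hv ht hh hc)

/-- The discrete product rule: the increment of `u` is paired with the shifted `v(h + s)`, that of
`v` with the unshifted `u(s)`. Integrated over `(0,t)`, the increment of `⟨u, v⟩` telescopes to the
two end windows. -/
theorem IsEvolution.integral_inner_window (hu : IsEvolution j u U f) (hv : IsEvolution j v W g)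
    {t h : ℝ} (ht : t ∈ Ico (0 : ℝ) 1) (hh : h ∈ Ioo 0 (1 - t)) :
    (∫ s in t..(t + h), ⟪u s, v s⟫_ℝ) - ∫ s in (0 : ℝ)..(0 + h), ⟪u s, v s⟫_ℝ =
      (∫ r in (0 : ℝ)..h, ∫ s in Ioc 0 t, zeroExt f (r + s) (zeroExt W (h + s))) +
      ∫ r in (0 : ℝ)..h, ∫ s in Ioc 0 t, zeroExt g (r + s) (zeroExt U (0 + s)) := by
  have hhI : h ∈ Icc 0 h := ⟨hh.1.le, le_rfl⟩
  have h0I : (0 : ℝ) ∈ Icc 0 h := ⟨le_rfl, hh.1.le⟩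
  rw [← hu.integral_increment hv ht hh hhI, ← hv.integral_increment hu ht hh h0I]
  have hc : ContinuousOn (fun s => ⟪u s, v s⟫_ℝ) (Icc 0 1) := hu.continuousOn.inner hv.continuousOn
  have hin : ∀ a b, a ∈ Icc (0 : ℝ) 1 → b ∈ Icc (0 : ℝ) 1 →
      IntervalIntegrable (fun s => ⟪u s, v s⟫_ℝ) volume a b := fun a b ha hb =>
    (hc.mono ((convex_Icc (0 : ℝ) 1).ordConnected.uIcc_subset ha hb)).intervalIntegrable
  have e0 : (0 : ℝ) ∈ Icc (0 : ℝ) 1 := ⟨le_rfl, zero_le_one⟩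
  have et : t ∈ Icc (0 : ℝ) 1 := ⟨ht.1, ht.2.le⟩
  have eh : h ∈ Icc (0 : ℝ) 1 := ⟨hh.1.le, by linarith [hh.2, ht.1]⟩
  have eth : h + t ∈ Icc (0 : ℝ) 1 := by constructor <;> linarith [hh.1, hh.2, ht.1]
  have ah : h ∈ Icc 0 (1 - t) := ⟨hh.1.le, hh.2.le⟩
  have a0 : (0 : ℝ) ∈ Icc 0 (1 - t) := ⟨le_rfl, by linarith [ht.2]⟩
  have hti : ∀ {a b : ℝ} {k l : ℝ → H}, ContinuousOn k (Icc 0 1) → ContinuousOn l (Icc 0 1) →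
      a ∈ Icc 0 (1 - t) → b ∈ Icc 0 (1 - t) →
      IntervalIntegrable (fun s => ⟪k (a + s), l (b + s)⟫_ℝ) volume 0 t := fun hk hl ha hb =>
    (by rw [uIcc_of_le ht.1]; exact continuousOn_inner_translate hk hl ha hb :
      ContinuousOn _ (uIcc 0 t)).intervalIntegrable
  have i1 := hti hu.continuousOn hv.continuousOn ah ah
  have i2 := hti hu.continuousOn hv.continuousOn a0 ah
  have i3 := hti hv.continuousOn hu.continuousOn ah a0
  have i4 := hti hv.continuousOn hu.continuousOn a0 a0
  simp only [zero_add] at i2 i3 i4 ⊢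
  have r1 : ∫ s in (0 : ℝ)..t, ⟪u (h + s) - u s, v (h + s)⟫_ℝ =
      (∫ s in (0 : ℝ)..t, ⟪u (h + s), v (h + s)⟫_ℝ) - ∫ s in (0 : ℝ)..t, ⟪u s, v (h + s)⟫_ℝ := by
    rw [← intervalIntegral.integral_sub i1 i2]; simp only [inner_sub_left]
  have r2 : ∫ s in (0 : ℝ)..t, ⟪v (h + s) - v s, u s⟫_ℝ =
      (∫ s in (0 : ℝ)..t, ⟪u s, v (h + s)⟫_ℝ) - ∫ s in (0 : ℝ)..t, ⟪u s, v s⟫_ℝ := by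
    simp only [inner_sub_left]
    rw [intervalIntegral.integral_sub i3 i4]
    simp only [real_inner_comm]
  rw [r1, r2, intervalIntegral.integral_comp_add_left (fun s => ⟪u s, v s⟫_ℝ), add_zero,
    add_comm t h, sub_add_sub_cancel]
  have s1 := intervalIntegral.integral_add_adjacent_intervals (hin h t eh et) (hin t (h + t) et eth)
  have s2 := intervalIntegral.integral_add_adjacent_intervals (hin 0 h e0 eh) (hin h t eh et)
  linarith

/-- Integration by parts in `W(0,1)`. -/
theorem IsEvolution.inner_eq (hu : IsEvolution j u U f) (hv : IsEvolution j v W g) {t : ℝ}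
    (ht : t ∈ Icc (0 : ℝ) 1) :
    ⟪u t, v t⟫_ℝ = ⟪u 0, v 0⟫_ℝ + ∫ s in (0 : ℝ)..t, (f s (W s) + g s (U s)) := by
  have hc : ContinuousOn (fun s => ⟪u s, v s⟫_ℝ) (Icc 0 1) := hu.continuousOn.inner hv.continuousOn
  have hfi := integrable_pairing hu.memLp_dt hv.memLp_val
  have hgi := integrable_pairing hv.memLp_dt hu.memLp_val
  have hint : IntegrableOn (fun s => f s (W s) + g s (U s)) (uIcc 0 1) volume := by
    rw [uIcc_of_le zero_le_one]
    exact (integrableOn_Icc_iff_integrableOn_Ioo (by simp) (by simp)).2 (hfi.add hgi)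
  have hprim : ContinuousOn (fun t => ∫ s in (0 : ℝ)..t, (f s (W s) + g s (U s))) (Icc 0 1) := by
    have := intervalIntegral.continuousOn_primitive_interval hint
    rwa [uIcc_of_le zero_le_one] at this
  -- Divide the window identity by `h` and let `h ↓ 0`; `t < 1` leaves room for the window.
  have key : EqOn (fun t => ⟪u t, v t⟫_ℝ)
      (fun t => ⟪u 0, v 0⟫_ℝ + ∫ s in (0 : ℝ)..t, (f s (W s) + g s (U s))) (Ico 0 1) := by
    intro t ht
    have hL := (tendsto_average_of_continuousOn hc ht).sub
      (tendsto_average_of_continuousOn hc (⟨le_rfl, zero_lt_one⟩ : (0 : ℝ) ∈ Ico (0 : ℝ) 1))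
    have hR := (tendsto_average_of_continuous (continuous_integral_pairing_translates
        (memLp_zeroExt hu.memLp_dt) (memLp_zeroExt hv.memLp_val) (Ioc 0 t))
        continuous_id rfl).add
      (tendsto_average_of_continuous (continuous_integral_pairing_translates
        (memLp_zeroExt hv.memLp_dt) (memLp_zeroExt hu.memLp_val) (Ioc 0 t))
        (continuous_const (y := (0 : ℝ))) rfl)
    have he := tendsto_nhds_unique (hL.congr' ?_) hR
    · have hz : ∀ {k : ℝ → StrongDual ℝ V} {l : ℝ → V},
          ∫ s in Ioc 0 t, zeroExt k (0 + s) (zeroExt l (0 + s)) = ∫ s in (0 : ℝ)..t, k s (l s) := by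
        intro k l
        rw [intervalIntegral.integral_of_le ht.1]
        refine setIntegral_congr_fun measurableSet_Ioc fun s hs => ?_
        have hs' : s ∈ Ioo (0 : ℝ) 1 := ⟨hs.1, by linarith [hs.2, ht.2]⟩
        simp only [zeroExt, zero_add, indicator_of_mem hs']
      have e0 : (0 : ℝ) ∈ Icc (0 : ℝ) 1 := ⟨le_rfl, zero_le_one⟩
      have et : t ∈ Icc (0 : ℝ) 1 := ⟨ht.1, ht.2.le⟩
      simp only [hz] at he
      simp only
      rw [intervalIntegral.integral_add (intervalIntegrable_of_timeMeasure hfi e0 et)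
        (intervalIntegrable_of_timeMeasure hgi e0 et)]
      linarith
    · filter_upwards [Ioo_mem_nhdsGT (sub_pos.2 ht.2)] with h hh
      rw [← mul_sub, hu.integral_inner_window hv ht hh, mul_add]
      rfl
  -- The endpoint `t = 1` follows by continuity of both sides.
  exact key.of_subset_closure hc (continuousOn_const.add hprim) Ico_subset_Icc_self
    (by rw [closure_Ico zero_ne_one]) ht

end Evolution

/-! ### Structural functions and growth of the linear functional. -/

section Structural

variable {X : Type} [MeasurableSpace X] {ρ : Measure X}

instance [IsFiniteMeasure ρ] : IsFiniteMeasure (stMeasure ρ) := by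
  unfold stMeasure; infer_instance

/-- Take `Ψ(ε) = ε + ∫ min(1, ε/|p|)`. The integrand is concave in `ε` and dominates the indicator
of `{|p| ≤ ε}` where `p ≠ 0`; the summand `ε` makes `Ψ` strictly increasing and unbounded. -/
theorem exists_isStructuralFunction [IsFiniteMeasure ρ] (p : Q ρ)
    (hnodal : stMeasure ρ {y | p y = 0} = 0) : ∃ Ψ : ℝ → ℝ, IsStructuralFunction p Ψ := by
  have hpm : Measurable p := (Lp.stronglyMeasurable p).measurable
  have hmeas : ∀ ε : ℝ, Measurable fun y => min 1 (ε / |p y|) := fun ε =>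
    measurable_const.min (measurable_const.div hpm.abs)
  have hbd : ∀ ε ∈ Ici (0 : ℝ), ∀ y, ‖min 1 (ε / |p y|)‖ ≤ (1 : ℝ) := fun ε hε y => by
    rw [Real.norm_of_nonneg (le_min zero_le_one (div_nonneg hε (abs_nonneg _)))]
    exact min_le_left _ _
  have hint : ∀ ε ∈ Ici (0 : ℝ), Integrable (fun y => min 1 (ε / |p y|)) (stMeasure ρ) :=
    fun ε hε => (integrable_const (1 : ℝ)).mono' (hmeas ε).aestronglyMeasurable
      (Eventually.of_forall (hbd ε hε))
  have hmono : ∀ a ∈ Ici (0 : ℝ), ∀ b ∈ Ici (0 : ℝ), a ≤ b →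
      ∫ y, min 1 (a / |p y|) ∂(stMeasure ρ) ≤ ∫ y, min 1 (b / |p y|) ∂(stMeasure ρ) :=
    fun a ha b hb hab => integral_mono (hint a ha) (hint b hb) fun y => by
      dsimp only; gcongr
  have hnn : ∀ ε ∈ Ici (0 : ℝ), 0 ≤ ∫ y, min 1 (ε / |p y|) ∂(stMeasure ρ) := fun ε hε =>
    integral_nonneg fun y => le_min zero_le_one (div_nonneg hε (abs_nonneg _))
  refine ⟨fun ε => ε + ∫ y, min 1 (ε / |p y|) ∂(stMeasure ρ), ?_, ?_, ?_, ?_, ?_, ?_⟩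
  · refine (concaveOn_id (convex_Ici 0)).add ⟨convex_Ici 0, fun x hx y hy a b ha hb hab => ?_⟩
    simp only [smul_eq_mul]
    have hxy : a * x + b * y ∈ Ici (0 : ℝ) :=
      add_nonneg (mul_nonneg ha hx) (mul_nonneg hb hy)
    rw [← integral_const_mul, ← integral_const_mul,
      ← integral_add ((hint x hx).const_mul a) ((hint y hy).const_mul b)]
    refine integral_mono (((hint x hx).const_mul a).add ((hint y hy).const_mul b))
      (hint _ hxy) fun z => ?_
    simp only
    refine le_min ?_ ?_
    · nlinarith [mul_le_mul_of_nonneg_left (min_le_left 1 (x / |p z|)) ha,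
        mul_le_mul_of_nonneg_left (min_le_left 1 (y / |p z|)) hb]
    · rw [add_div, mul_div_assoc, mul_div_assoc]
      exact add_le_add (mul_le_mul_of_nonneg_left (min_le_right _ _) ha)
        (mul_le_mul_of_nonneg_left (min_le_right _ _) hb)
  · refine continuousOn_id.add (continuousOn_of_dominated (bound := fun _ => (1 : ℝ))
      (fun ε _ => (hmeas ε).aestronglyMeasurable)
      (fun ε hε => Eventually.of_forall (hbd ε hε)) (integrable_const _)
      (Eventually.of_forall fun y => ?_))
    exact (continuous_const.min (continuous_id.div_const _)).continuousOn
  · exact fun a ha b hb hab => add_lt_add_of_lt_of_le hab (hmono a ha b hb hab.le)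
  · simp
  · refine tendsto_atTop_mono' _ ?_ tendsto_id
    filter_upwards [eventually_ge_atTop 0] with ε hε
    exact le_add_of_nonneg_right (hnn ε hε)
  · intro ε hε
    have hS : MeasurableSet {y | -ε ≤ p y ∧ p y ≤ ε} :=
      (measurableSet_le measurable_const hpm).inter (measurableSet_le hpm measurable_const)
    rw [← ofReal_measureReal, ← integral_indicator_one hS]
    refine ENNReal.ofReal_le_ofReal (le_add_of_nonneg_of_le (le_of_lt hε) ?_)
    refine integral_mono_ae ((integrable_const (1 : ℝ)).indicator hS) (hint ε (le_of_lt hε)) ?_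
    -- Where `p = 0` the quotient `ε / |p|` has the default value `0` and the bound fails, so the
    -- nodal set must be null.
    have hne : ∀ᵐ y ∂(stMeasure ρ), p y ≠ 0 := by rw [ae_iff]; simpa using hnodal
    filter_upwards [hne] with y hy
    by_cases hys : y ∈ {y | -ε ≤ p y ∧ p y ≤ ε}
    · rw [indicator_of_mem hys]
      refine le_min le_rfl ?_
      rw [le_div_iff₀ (abs_pos.2 hy), Pi.one_apply, one_mul]
      exact abs_le.2 hys
    · rw [indicator_of_notMem hys]
      exact le_min zero_le_one (div_nonneg (le_of_lt hε) (abs_nonneg _))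

variable {p : Q ρ} {Ψ : ℝ → ℝ}

theorem IsStructuralFunction.exists_eq (h : IsStructuralFunction p Ψ) {y : ℝ} (hy : 0 ≤ y) :
    ∃ x ∈ Ici (0 : ℝ), Ψ x = y := by
  obtain ⟨b, hb, hb0⟩ := ((h.tendsto.eventually_ge_atTop y).and (eventually_ge_atTop 0)).exists
  obtain ⟨x, hx, rfl⟩ := intermediate_value_Icc hb0 (h.continuousOn.mono Icc_subset_Ici_self)
    (⟨by rw [h.zero]; exact hy, hb⟩ : y ∈ Icc (Ψ 0) (Ψ b))
  exact ⟨x, hx.1, rfl⟩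

theorem IsStructuralFunction.psiInv_nonneg (h : IsStructuralFunction p Ψ) {y : ℝ} (hy : 0 ≤ y) :
    0 ≤ psiInv Ψ y := Function.invFunOn_mem (h.exists_eq hy)

theorem IsStructuralFunction.apply_psiInv (h : IsStructuralFunction p Ψ) {y : ℝ} (hy : 0 ≤ y) :
    Ψ (psiInv Ψ y) = y := Function.invFunOn_eq (h.exists_eq hy)

theorem IsStructuralFunction.psiInv_mono (h : IsStructuralFunction p Ψ) {x y : ℝ} (hx : 0 ≤ x)
    (hxy : x ≤ y) : psiInv Ψ x ≤ psiInv Ψ y := by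
  have hy := hx.trans hxy
  rw [← h.strictMono.le_iff_le (h.psiInv_nonneg hx) (h.psiInv_nonneg hy), h.apply_psiInv hx,
    h.apply_psiInv hy]
  exact hxy

theorem IsStructuralFunction.psiInv_pos (h : IsStructuralFunction p Ψ) {y : ℝ} (hy : 0 < y) :
    0 < psiInv Ψ y := by
  refine lt_of_le_of_ne (h.psiInv_nonneg hy.le) fun h0 => ?_
  have := h.apply_psiInv hy.le
  rw [← h0, h.zero] at this
  exact hy.ne this

theorem l1Dist_nonneg (q r : Q ρ) : 0 ≤ l1Dist q r := integral_nonneg fun _ => abs_nonneg _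

variable {qa qb : ℝ} {q r : Q ρ}

theorem ae_abs_sub_le (hq : q ∈ Qad ρ qa qb) (hr : r ∈ Qad ρ qa qb) :
    ∀ᵐ y ∂(stMeasure ρ), |q y - r y| ≤ qb - qa := by
  filter_upwards [hq, hr] with y h1 h2
  rw [abs_le]; constructor <;> linarith [h1.1, h1.2, h2.1, h2.2]

theorem integrable_mul_sub (p q r : Q ρ) :
    Integrable (fun y => p y * (q y - r y)) (stMeasure ρ) :=
  (Lp.memLp p).integrable_mul ((Lp.memLp q).sub (Lp.memLp r))

theorem integrable_sub_sq (q r : Q ρ) :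
    Integrable (fun y => (q y - r y) ^ 2) (stMeasure ρ) :=
  ((Lp.memLp q).sub (Lp.memLp r)).integrable_sq

theorem integrable_abs_sub [IsFiniteMeasure ρ] (q r : Q ρ) :
    Integrable (fun y => |q y - r y|) (stMeasure ρ) :=
  (((Lp.memLp q).sub (Lp.memLp r)).integrable one_le_two).abs

theorem integral_sub_sq_le [IsFiniteMeasure ρ] (hq : q ∈ Qad ρ qa qb) (hr : r ∈ Qad ρ qa qb) :
    ∫ y, (q y - r y) ^ 2 ∂(stMeasure ρ) ≤ (qb - qa) * l1Dist q r := by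
  unfold l1Dist
  rw [← integral_const_mul]
  refine integral_mono_ae (integrable_sub_sq q r) ((integrable_abs_sub q r).const_mul _) ?_
  filter_upwards [ae_abs_sub_le hq hr] with y hy
  rw [← sq_abs, sq]
  exact mul_le_mul_of_nonneg_right hy (abs_nonneg _)

theorem l1Dist_le [IsFiniteMeasure ρ] (hq : q ∈ Qad ρ qa qb) (hr : r ∈ Qad ρ qa qb) :
    l1Dist q r ≤ (stMeasure ρ).real univ * (qb - qa) := by
  unfold l1Dist
  refine (integral_mono_ae (integrable_abs_sub q r) (integrable_const (qb - qa))
    (ae_abs_sub_le hq hr)).trans_eq ?_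
  simp

/-- Bang-bang principle: the competitor `b`, equal to `qa` where `p > 0` and `qb` elsewhere,
minimizes `p q` pointwise. The variational inequality at `b` then forces `p (b - r) = 0`, hence `r =
b` off the nodal set, and `q - r` has the sign of `p`. -/
theorem ae_mul_sub_eq_abs [IsFiniteMeasure ρ] (hab : qa < qb)
    (hnodal : stMeasure ρ {y | p y = 0} = 0) (hr : r ∈ Qad ρ qa qb)
    (hvar : ∀ q ∈ Qad ρ qa qb, 0 ≤ ∫ y, p y * (q y - r y) ∂(stMeasure ρ))
    (hq : q ∈ Qad ρ qa qb) :
    ∀ᵐ y ∂(stMeasure ρ), p y * (q y - r y) = |p y| * |q y - r y| := by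
  classical
  have hpm : Measurable p := (Lp.stronglyMeasurable p).measurable
  let b : ℝ × X → ℝ := fun y => if 0 < p y then qa else qb
  have hbm : Measurable b :=
    Measurable.ite (measurableSet_lt measurable_const hpm) measurable_const measurable_const
  have hbL : MemLp b 2 (stMeasure ρ) := by
    refine MemLp.of_bound hbm.aestronglyMeasurable (max |qa| |qb|) (Eventually.of_forall fun y => ?_)
    simp only [b]
    split_ifs
    exacts [le_max_left _ _, le_max_right _ _]
  have hbe : ∀ᵐ y ∂(stMeasure ρ), hbL.toLp b y = b y := hbL.coeFn_toLp
  have hbad : hbL.toLp b ∈ Qad ρ qa qb := by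
    filter_upwards [hbe] with y hy
    rw [hy]
    simp only [b]
    split_ifs
    exacts [⟨le_rfl, hab.le⟩, ⟨hab.le, le_rfl⟩]
  have hle : ∀ᵐ y ∂(stMeasure ρ), p y * (hbL.toLp b y - r y) ≤ 0 := by
    filter_upwards [hbe, hr] with y hy hry
    rw [hy]
    simp only [b]
    split_ifs with h
    · exact mul_nonpos_of_nonneg_of_nonpos h.le (by linarith [hry.1])
    · exact mul_nonpos_of_nonpos_of_nonneg (not_lt.1 h) (by linarith [hry.2])
  have hz : ∀ᵐ y ∂(stMeasure ρ), -(p y * (hbL.toLp b y - r y)) = 0 := by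
    refine (integral_eq_zero_iff_of_nonneg_ae ?_ (integrable_mul_sub _ _ _).neg).1 ?_
    · filter_upwards [hle] with y hy using neg_nonneg.2 hy
    · refine le_antisymm ?_ (integral_nonneg_of_ae ?_)
      · have := hvar _ hbad
        simp only [Pi.neg_apply]
        rw [integral_neg]; linarith
      · filter_upwards [hle] with y hy using neg_nonneg.2 hy
  have hne : ∀ᵐ y ∂(stMeasure ρ), p y ≠ 0 := by rw [ae_iff]; simpa using hnodal
  filter_upwards [hz, hbe, hne, hq] with y h1 h2 h3 h4
  have h5 : b y = r y := by
    rw [h2, neg_eq_zero, mul_eq_zero] at h1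
    linarith [h1.resolve_left h3]
  rw [← h5]
  simp only [b]
  split_ifs with h
  · rw [abs_of_pos h, abs_of_nonneg (by linarith [h4.1])]
  · rw [abs_of_nonpos (not_lt.1 h), abs_of_nonpos (by linarith [h4.2] : q y - qb ≤ 0)]; ring

/-- The growth of the linear functional `p` on `Q_ad` at its minimizer. -/
theorem IsStructuralFunction.growth [IsFiniteMeasure ρ] (h : IsStructuralFunction p Ψ)
    (hab : qa < qb) (hnodal : stMeasure ρ {y | p y = 0} = 0) (hr : r ∈ Qad ρ qa qb)
    (hvar : ∀ q ∈ Qad ρ qa qb, 0 ≤ ∫ y, p y * (q y - r y) ∂(stMeasure ρ))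
    (hq : q ∈ Qad ρ qa qb) :
    1 / 2 * psiInv Ψ ((2 * (qb - qa))⁻¹ * l1Dist q r) * l1Dist q r ≤
      ∫ y, p y * (q y - r y) ∂(stMeasure ρ) := by
  rcases (l1Dist_nonneg q r).eq_or_lt with h0 | hpos
  · rw [← h0, mul_zero]; exact hvar q hq
  have hba : 0 < qb - qa := sub_pos.2 hab
  have hy : 0 < (2 * (qb - qa))⁻¹ * l1Dist q r := by positivity
  -- With this `ε`, the set `{|p| ≤ ε}` carries at most `Ψ ε * (qb - qa)`, half of the `L¹`
  -- distance; on the rest the integrand is at least `ε |q - r|`.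
  set ε := psiInv Ψ ((2 * (qb - qa))⁻¹ * l1Dist q r) with hεdef
  have hε : 0 < ε := h.psiInv_pos hy
  have hΨ : Ψ ε = (2 * (qb - qa))⁻¹ * l1Dist q r := h.apply_psiInv hy.le
  have hpm : Measurable p := (Lp.stronglyMeasurable p).measurable
  set S : Set (ℝ × X) := {y | -ε ≤ p y ∧ p y ≤ ε} with hSdef
  have hS : MeasurableSet S :=
    (measurableSet_le measurable_const hpm).inter (measurableSet_le hpm measurable_const)
  have hSle : (stMeasure ρ).real S ≤ Ψ ε :=
    ENNReal.toReal_le_of_le_ofReal (by rw [hΨ]; exact hy.le) (h.measure_le ε hε)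
  have hi2 : Integrable (S.indicator fun _ => (qb - qa)) (stMeasure ρ) :=
    (integrable_const _).indicator hS
  have hlow : ε * (l1Dist q r - (stMeasure ρ).real S * (qb - qa)) ≤
      ∫ y, p y * (q y - r y) ∂(stMeasure ρ) := by
    have e : ε * (l1Dist q r - (stMeasure ρ).real S * (qb - qa)) =
        ∫ y, ε * (|q y - r y| - S.indicator (fun _ => (qb - qa)) y) ∂(stMeasure ρ) := by
      rw [integral_const_mul, integral_sub (integrable_abs_sub q r) hi2,
        integral_indicator_const _ hS, smul_eq_mul, l1Dist]
    rw [e]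
    refine integral_mono_ae (((integrable_abs_sub q r).sub hi2).const_mul ε)
      (integrable_mul_sub p q r) ?_
    filter_upwards [ae_mul_sub_eq_abs hab hnodal hr hvar hq, ae_abs_sub_le hq hr] with y h1 h2
    rw [h1]
    by_cases hyS : y ∈ S
    · rw [indicator_of_mem hyS]
      exact (mul_nonpos_of_nonneg_of_nonpos hε.le (by linarith)).trans (by positivity)
    · rw [indicator_of_notMem hyS, sub_zero]
      have : ε ≤ |p y| := by
        by_contra hlt
        exact hyS (abs_le.1 (not_le.1 hlt).le)
      exact mul_le_mul_of_nonneg_right this (abs_nonneg _)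
  refine le_trans (le_of_eq_of_le ?_ (mul_le_mul_of_nonneg_left (sub_le_sub_left
    (mul_le_mul_of_nonneg_right hSle hba.le) _) hε.le)) hlow
  rw [hΨ]; field_simp; ring

end Structural

/-! ### Time slices and Fubini. -/

section Slices

variable {X : Type} [MeasurableSpace X] {ρ : Measure X} [IsFiniteMeasure ρ]

theorem ae_memLp_slice (q : Q ρ) : ∀ᵐ t ∂timeMeasure, MemLp (fun x => q (t, x)) 2 ρ := by
  have hi : Integrable (fun y => q y ^ 2) (timeMeasure.prod ρ) := (Lp.memLp q).integrable_sq
  filter_upwards [hi.prod_right_ae] with t ht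
  exact (memLp_two_iff_integrable_sq
    ((Lp.stronglyMeasurable q).comp_measurable measurable_prodMk_left).aestronglyMeasurable).2 ht

theorem ae_slice_eq (q : Q ρ) :
    ∀ᵐ t ∂timeMeasure, slice q t =ᵐ[ρ] fun x => q (t, x) := by
  filter_upwards [ae_memLp_slice q] with t ht
  rw [slice, dif_pos ht]
  exact ht.coeFn_toLp

theorem ae_inner_slice_sub (p q r : Q ρ) : ∀ᵐ t ∂timeMeasure,
    ⟪slice p t, slice q t - slice r t⟫_ℝ = ∫ x, p (t, x) * (q (t, x) - r (t, x)) ∂ρ := by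
  filter_upwards [ae_slice_eq p, ae_slice_eq q, ae_slice_eq r] with t h1 h2 h3
  rw [L2.inner_def]
  refine integral_congr_ae ?_
  filter_upwards [h1, h2, h3, Lp.coeFn_sub (slice q t) (slice r t)] with x e1 e2 e3 e4
  rw [e4, e1, Pi.sub_apply, e2, e3]
  simp [mul_comm]

theorem ae_norm_slice_sub_sq (q r : Q ρ) : ∀ᵐ t ∂timeMeasure,
    ‖slice q t - slice r t‖ ^ 2 = ∫ x, (q (t, x) - r (t, x)) ^ 2 ∂ρ := by
  filter_upwards [ae_slice_eq q, ae_slice_eq r] with t h2 h3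
  rw [← real_inner_self_eq_norm_sq, L2.inner_def]
  refine integral_congr_ae ?_
  filter_upwards [h2, h3, Lp.coeFn_sub (slice q t) (slice r t)] with x e2 e3 e4
  rw [e4, Pi.sub_apply, e2, e3]
  simp

theorem ae_norm_slice_sq (q : Q ρ) : ∀ᵐ t ∂timeMeasure,
    ‖slice q t‖ ^ 2 = ∫ x, q (t, x) ^ 2 ∂ρ := by
  filter_upwards [ae_slice_eq q] with t h2
  rw [← real_inner_self_eq_norm_sq, L2.inner_def]
  refine integral_congr_ae ?_
  filter_upwards [h2] with x e2
  rw [e2]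
  simp

theorem integrable_norm_slice_sub_sq (q r : Q ρ) :
    Integrable (fun t => ‖slice q t - slice r t‖ ^ 2) timeMeasure := by
  refine Integrable.congr (Integrable.integral_prod_left (integrable_sub_sq q r)) ?_
  filter_upwards [ae_norm_slice_sub_sq q r] with t ht using ht.symm

theorem integrable_norm_slice_sq (q : Q ρ) :
    Integrable (fun t => ‖slice q t‖ ^ 2) timeMeasure := by
  refine Integrable.congr (Integrable.integral_prod_left (Lp.memLp q).integrable_sq) ?_
  filter_upwards [ae_norm_slice_sq q] with t ht using ht.symm

theorem integral_norm_slice_sub_sq (q r : Q ρ) :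
    ∫ t, ‖slice q t - slice r t‖ ^ 2 ∂timeMeasure = ∫ y, (q y - r y) ^ 2 ∂(stMeasure ρ) := by
  rw [integral_congr_ae (ae_norm_slice_sub_sq q r)]
  exact (integral_prod _ (integrable_sub_sq q r)).symm

variable {d : ℕ} {Ω : Set (Sp d)} {B : Lp ℝ 2 ρ →L[ℝ] L2 Ω}

theorem IsObservation.integral_eq {z : W Ω} {p : Q ρ} (hp : IsObservation B z p) (q r : Q ρ) :
    ∫ t in (0 : ℝ)..1, ⟪ContinuousLinearMap.adjoint B (z.path t), slice q t - slice r t⟫_ℝ =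
      ∫ y, p y * (q y - r y) ∂(stMeasure ρ) := by
  rw [← integral_timeMeasure]
  refine Eq.trans (integral_congr_ae ?_) (integral_prod _ (integrable_mul_sub p q r)).symm
  filter_upwards [hp, ae_inner_slice_sub p q r] with t h1 h2
  rw [← h1, h2]

end Slices

/-! ### An abstract energy estimate. -/

section Energy

variable {H V : Type*} [NormedAddCommGroup H] [InnerProductSpace ℝ H]
  [NormedAddCommGroup V] [NormedSpace ℝ V]
  {j : V →L[ℝ] H} {w : ℝ → H} {U : ℝ → V} {f : ℝ → StrongDual ℝ V}

/-- The energy estimate: dissipation is controlled by the source. -/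
theorem IsEvolution.integral_dissipation_le (hw : IsEvolution j w U f) (h0 : w 0 = 0)
    {α β : ℝ → ℝ} (hα : Integrable α timeMeasure) (hβ : Integrable β timeMeasure)
    (hα0 : ∀ t, 0 ≤ α t) (hβ0 : ∀ t, 0 ≤ β t)
    (hle : ∀ᵐ t ∂timeMeasure, f t (U t) ≤ -α t + β t + 1 / 4 * ‖w t‖ ^ 2) :
    ∫ t, α t ∂timeMeasure ≤ 2 * ∫ t, β t ∂timeMeasure := by
  obtain ⟨τ, hτ, hmax⟩ := isCompact_Icc.exists_isMaxOn (nonempty_Icc.2 zero_le_one)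
    hw.continuousOn.norm
  have e0 : (0 : ℝ) ∈ Icc (0 : ℝ) 1 := ⟨le_rfl, zero_le_one⟩
  have e1 : (1 : ℝ) ∈ Icc (0 : ℝ) 1 := ⟨zero_le_one, le_rfl⟩
  set M := ‖w τ‖ with hM
  have hf := integrable_pairing hw.memLp_dt hw.memLp_val
  have hii : ∀ {k : ℝ → ℝ} {t : ℝ}, Integrable k timeMeasure → t ∈ Icc (0 : ℝ) 1 →
      IntervalIntegrable k volume 0 t := fun hk ht => intervalIntegrable_of_timeMeasure hk e0 ht
  have key : ∀ t ∈ Icc (0 : ℝ) 1, 1 / 2 * ‖w t‖ ^ 2 + ∫ s in (0 : ℝ)..t, α s ≤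
      ∫ s, β s ∂timeMeasure + 1 / 4 * M ^ 2 := by
    intro t ht
    have he := hw.inner_eq hw ht
    rw [h0, inner_zero_left, zero_add, intervalIntegral.integral_add (hii hf ht) (hii hf ht),
      real_inner_self_eq_norm_sq] at he
    have hmono : ∫ s in (0 : ℝ)..t, f s (U s) ≤
        ∫ s in (0 : ℝ)..t, (-α s + β s + 1 / 4 * M ^ 2) := by
      refine intervalIntegral.integral_mono_ae_restrict ht.1 (hii hf ht)
        (hii ((hα.neg.add hβ).add (integrable_const _)) ht) ?_
      rw [Measure.restrict_congr_set Ioo_ae_eq_Icc.symm, EventuallyLE,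
        ae_restrict_iff' measurableSet_Ioo]
      filter_upwards [ae_timeMeasure_iff.1 hle] with s hs hst
      have hs1 : s ∈ Ioo (0 : ℝ) 1 := ⟨hst.1, hst.2.trans_le ht.2⟩
      have hsM : ‖w s‖ ≤ M := hmax ⟨hs1.1.le, hs1.2.le⟩
      refine (hs hs1).trans ?_
      gcongr
    have hsplit : ∫ s in (0 : ℝ)..t, (-α s + β s + 1 / 4 * M ^ 2) =
        -(∫ s in (0 : ℝ)..t, α s) + (∫ s in (0 : ℝ)..t, β s) + t * (1 / 4 * M ^ 2) := by
      have hneg : IntervalIntegrable (fun s => -α s) volume 0 t := (hii hα ht).neg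
      rw [intervalIntegral.integral_add (hneg.add (hii hβ ht)) intervalIntegrable_const,
        intervalIntegral.integral_add hneg (hii hβ ht), intervalIntegral.integral_neg,
        intervalIntegral.integral_const, sub_zero, smul_eq_mul]
    have hβt : ∫ s in (0 : ℝ)..t, β s ≤ ∫ s, β s ∂timeMeasure := by
      rw [integral_timeMeasure]
      exact intervalIntegral.integral_mono_interval le_rfl ht.1 ht.2
        (Eventually.of_forall hβ0) (hii hβ e1)
    nlinarith [sq_nonneg M, ht.2, hmono, hsplit, hβt, he]
  -- At the maximum point the term `M²/4` is absorbed, so `M²/4 ≤ ∫ β`; inserting this at time `1`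
  -- gives the factor `2`, and Gronwall's inequality is not needed.
  have k1 := key τ hτ
  have k2 := key 1 e1
  rw [← integral_timeMeasure] at k2
  have hατ : 0 ≤ ∫ s in (0 : ℝ)..τ, α s :=
    intervalIntegral.integral_nonneg hτ.1 fun s _ => hα0 s
  rw [← hM] at k1
  nlinarith [sq_nonneg ‖w 1‖]

end Energy

/-! ### The state equation: linearization and stability. -/

section Equation

variable {d : ℕ} {Ω : Set (Sp d)}

theorem emb_apply (f : L2 Ω) (φ : H10 Ω) : emb Ω f φ = ⟪f, toL2 Ω φ⟫_ℝ := rfl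

theorem lap_apply (u φ : H10 Ω) : lap Ω u φ = -⟪grad Ω u, grad Ω φ⟫_ℝ := rfl

theorem lap_apply_comm (u φ : H10 Ω) : lap Ω u φ = lap Ω φ u := by
  rw [lap_apply, lap_apply, real_inner_comm]

theorem W.isEvolution (u : W Ω) : IsEvolution (toL2 Ω) u.path u.val u.dt where
  continuousOn := u.path_continuousOn
  memLp_val := Lp.memLp _
  memLp_dt := Lp.memLp _
  ae_eq := u.path_ae
  primitive t ht φ := by
    have := congrArg (fun k : Hm1 Ω => k φ) (u.path_primitive t ht)
    simpa only [add_apply, emb_apply] using this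

theorem W.memLp_grad (u : W Ω) : MemLp (fun t => grad Ω (u.val t)) 2 timeMeasure :=
  (Lp.memLp u.val).continuousLinearMap_comp (grad Ω)

theorem W.integrable_norm_grad_sq (u : W Ω) :
    Integrable (fun t => ‖grad Ω (u.val t)‖ ^ 2) timeMeasure :=
  (memLp_two_iff_integrable_sq_norm u.memLp_grad.1).1 u.memLp_grad

theorem W.integrable_norm_toL2_sq (u : W Ω) :
    Integrable (fun t => ‖toL2 Ω (u.val t)‖ ^ 2) timeMeasure :=
  have h : MemLp (fun t => toL2 Ω (u.val t)) 2 timeMeasure :=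
    (Lp.memLp u.val).continuousLinearMap_comp (toL2 Ω)
  (memLp_two_iff_integrable_sq_norm h.1).1 h

theorem W.integrable_norm_grad_sub_sq (u v : W Ω) :
    Integrable (fun t => ‖grad Ω (u.val t - v.val t)‖ ^ 2) timeMeasure :=
  have h : MemLp (fun t => grad Ω (u.val t - v.val t)) 2 timeMeasure :=
    ((Lp.memLp u.val).sub (Lp.memLp v.val)).continuousLinearMap_comp (grad Ω)
  (memLp_two_iff_integrable_sq_norm h.1).1 h

theorem W.integrable_lap (u z : W Ω) :
    Integrable (fun t => lap Ω (u.val t) (z.val t)) timeMeasure := by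
  have h : MemLp (fun t => innerSL ℝ (grad Ω (u.val t)) (grad Ω (z.val t))) 1 timeMeasure :=
    (innerSL ℝ).memLp_of_bilin (p := 2) (q := 2) 1 u.memLp_grad z.memLp_grad
  exact (memLp_one_iff_integrable.1 h).neg

variable {X : Type} [MeasurableSpace X] {ρ : Measure X} {B : Lp ℝ 2 ρ →L[ℝ] L2 Ω}
  {u₀ ud : H10 Ω} {ν νb δ₀ qa qb μb : ℝ} {q qbar : Q ρ} {u ubar z : W Ω}

theorem IsState.ae_dt_apply (hu : IsState B u₀ ν q u) : ∀ᵐ t ∂timeMeasure, ∀ φ : H10 Ω,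
    u.dt t φ = ν * lap Ω (u.val t) φ + ν * ⟪B (slice q t), toL2 Ω φ⟫_ℝ := by
  filter_upwards [hu.2] with t ht φ
  have := congrArg (fun k : Hm1 Ω => k φ) ht
  simp only [sub_apply, smul_apply, emb_apply, smul_eq_mul] at this
  linarith

theorem IsAdjointState.ae_dt_apply {z₁ : L2 Ω} (hz : IsAdjointState ν z₁ z) :
    ∀ᵐ t ∂timeMeasure, ∀ φ : H10 Ω, z.dt t φ = -(ν * lap Ω (z.val t) φ) := by
  filter_upwards [hz.2] with t ht φ
  have := congrArg (fun k : Hm1 Ω => k φ) ht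
  simp only [sub_apply, neg_apply, smul_apply, smul_eq_mul, zero_apply] at this
  linarith

/-- Solving the equation for the control term avoids any discussion of the measurability of `t ↦
slice q t`. -/
theorem IsState.integrable_control (hu : IsState B u₀ ν q u) (hν : 0 < ν) (z : W Ω) :
    Integrable (fun t => ⟪B (slice q t), toL2 Ω (z.val t)⟫_ℝ) timeMeasure := by
  refine (((integrable_pairing (Lp.memLp u.dt) (Lp.memLp z.val)).const_mul ν⁻¹).sub
    (u.integrable_lap z)).congr ?_
  filter_upwards [hu.ae_dt_apply] with t ht
  simp only [Pi.sub_apply]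
  rw [ht]
  field_simp
  ring

variable (B) in
/-- The change of `∫ ⟨Bq + Δu, z⟩` when `(q̄, ū)` is replaced by `(q, u)`. -/
def hamiltonianChange (q qbar : Q ρ) (u ubar z : W Ω) : ℝ :=
  ∫ t, (lap Ω (u.val t - ubar.val t) (z.val t) +
    ⟪B (slice q t - slice qbar t), toL2 Ω (z.val t)⟫_ℝ) ∂timeMeasure

theorem lap_sub_apply (u v φ : H10 Ω) : lap Ω (u - v) φ = lap Ω u φ - lap Ω v φ := by
  simp only [lap_apply, map_sub, inner_sub_left]; ring

set_option maxHeartbeats 1000000 in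
/-- The linearization of the terminal constraint along the adjoint state. -/
theorem FirstOrderConditions.inner_terminal
    (hf : FirstOrderConditions B u₀ ud δ₀ qa qb νb qbar ubar μb z)
    (hν : 0 < ν) (hu : IsState B u₀ ν q u) :
    ⟪u.path 1 - ubar.path 1, z.path 1⟫_ℝ =
      (ν - νb) * (hamiltonianChange B q qbar u ubar z - 1) +
      νb * ∫ t in (0 : ℝ)..1,
        ⟪ContinuousLinearMap.adjoint B (z.path t), slice q t - slice qbar t⟫_ℝ := by
  have e1 : (1 : ℝ) ∈ Icc (0 : ℝ) 1 := ⟨zero_le_one, le_rfl⟩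
  have hq := hu.integrable_control hν z
  have hqb := hf.state.integrable_control hf.time_pos z
  have hlu := u.integrable_lap z
  have hlub := ubar.integrable_lap z
  have hH : Integrable (fun t => lap Ω (u.val t - ubar.val t) (z.val t) +
      ⟪B (slice q t - slice qbar t), toL2 Ω (z.val t)⟫_ℝ) timeMeasure := by
    simp only [lap_sub_apply, map_sub, inner_sub_left]
    exact (hlu.sub hlub).add (hq.sub hqb)
  have hL : Integrable (fun t => ⟪ContinuousLinearMap.adjoint B (z.path t),
      slice q t - slice qbar t⟫_ℝ) timeMeasure := by
    refine (hq.sub hqb).congr ?_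
    filter_upwards [z.path_ae] with t ht
    rw [ContinuousLinearMap.adjoint_inner_left, ← ht, map_sub, inner_sub_right,
      real_inner_comm, real_inner_comm (B (slice qbar t))]
    rfl
  have hK : Integrable (fun t => (emb Ω (B (slice qbar t)) + lap Ω (ubar.val t)) (z.val t))
      timeMeasure := by
    simp only [add_apply, emb_apply]
    exact hqb.add hlub
  have hham : ∫ t, (emb Ω (B (slice qbar t)) + lap Ω (ubar.val t)) (z.val t) ∂timeMeasure = -1 := by
    have := hf.hamiltonian
    rw [← integral_timeMeasure, integral_add (integrable_const _) hK] at this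
    have h1 : ∫ _, (1 : ℝ) ∂timeMeasure = 1 := by
      rw [integral_timeMeasure]; simp
    linarith
  have hHK : Integrable (fun t => (lap Ω (u.val t - ubar.val t) (z.val t) +
      ⟪B (slice q t - slice qbar t), toL2 Ω (z.val t)⟫_ℝ) +
      (emb Ω (B (slice qbar t)) + lap Ω (ubar.val t)) (z.val t)) timeMeasure := hH.add hK
  have hparts := (u.isEvolution.sub ubar.isEvolution).inner_eq z.isEvolution e1
  rw [hu.1, hf.state.1, sub_self, inner_zero_left, zero_add, ← integral_timeMeasure] at hparts
  -- The constant `-1` is turned back into the Hamiltonian integral, so that both sides can be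
  -- compared pointwise in time. There the terms with `Δ(u - ū)` weighted by `ν̄` cancel against the
  -- adjoint equation, since `Δ` is symmetric.
  rw [hparts, ← integral_timeMeasure, hamiltonianChange, sub_eq_add_neg _ (1 : ℝ), ← hham,
    ← integral_add hH hK, ← integral_const_mul, ← integral_const_mul,
    ← integral_add (hHK.const_mul _) (hL.const_mul _)]
  refine integral_congr_ae ?_
  filter_upwards [hu.ae_dt_apply, hf.state.ae_dt_apply, hf.adjoint.ae_dt_apply, z.path_ae]
    with t h1 h2 h3 h4
  rw [ContinuousLinearMap.adjoint_inner_left, ← h4,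
    real_inner_comm (B (slice q t - slice qbar t)), h3]
  simp only [sub_apply, add_apply, emb_apply, map_sub, inner_sub_left, h1, h2, lap_sub_apply,
    lap_apply_comm (z.val t)]
  ring

/-- Expanding the square in `G` shows that `u(1) - ū(1)` makes a nonpositive inner product with
`ū(1) - u_d`, hence with its positive multiple `z̄(1)`. -/
theorem FirstOrderConditions.growth_le
    (hf : FirstOrderConditions B u₀ ud δ₀ qa qb νb qbar ubar μb z)
    (hν : 0 < ν) (hu : IsState B u₀ ν q u) (hG : G ud δ₀ (u.path 1) ≤ 0) :
    νb * ∫ t in (0 : ℝ)..1,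
        ⟪ContinuousLinearMap.adjoint B (z.path t), slice q t - slice qbar t⟫_ℝ ≤
      (ν - νb) * (1 - hamiltonianChange B q qbar u ubar z) := by
  have h1 := hf.inner_terminal hν hu
  have h2 : ⟪u.path 1 - ubar.path 1, ubar.path 1 - toL2 Ω ud⟫_ℝ ≤ 0 := by
    have hGb := hf.terminal
    unfold G at hG hGb
    have e : u.path 1 - toL2 Ω ud =
        (u.path 1 - ubar.path 1) + (ubar.path 1 - toL2 Ω ud) := by abel
    rw [e, norm_add_sq_real] at hG
    nlinarith [sq_nonneg ‖u.path 1 - ubar.path 1‖]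
  rw [hf.adjoint.1, inner_smul_right] at h1
  have h3 := mul_nonpos_of_nonneg_of_nonpos hf.multiplier_pos.le h2
  linarith

theorem young_inner {E : Type*} [NormedAddCommGroup E] [InnerProductSpace ℝ E] (x y : E)
    {κ : ℝ} (hκ : 0 < κ) : |⟪x, y⟫_ℝ| ≤ κ / 2 * ‖x‖ ^ 2 + 1 / (2 * κ) * ‖y‖ ^ 2 := by
  refine (abs_real_inner_le_norm x y).trans ?_
  have : κ / 2 * ‖x‖ ^ 2 + 1 / (2 * κ) * ‖y‖ ^ 2 - ‖x‖ * ‖y‖ =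
      (κ * ‖x‖ - ‖y‖) ^ 2 / (2 * κ) := by field_simp; ring
  have h : 0 ≤ (κ * ‖x‖ - ‖y‖) ^ 2 / (2 * κ) := by positivity
  linarith

theorem norm_control_sq_le (x : Lp ℝ 2 ρ) : ‖B x‖ ^ 2 ≤ ‖B‖ ^ 2 * ‖x‖ ^ 2 := by
  rw [← mul_pow]
  exact pow_le_pow_left₀ (norm_nonneg _) (B.le_opNorm x) 2

variable [IsFiniteMeasure ρ]

set_option maxHeartbeats 1000000 in
/-- Stability of the state in `L²(I; H¹₀)` with respect to time and control. -/
theorem IsState.integral_grad_sub_le (hν : 0 < ν) (hu : IsState B u₀ ν q u)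
    (hub : IsState B u₀ νb qbar ubar) :
    ν / 2 * ∫ t, ‖grad Ω (u.val t - ubar.val t)‖ ^ 2 ∂timeMeasure ≤
      2 * (2 * ν ^ 2 * ‖B‖ ^ 2 * ∫ y, (q y - qbar y) ^ 2 ∂(stMeasure ρ) +
        2 * (ν - νb) ^ 2 * ‖B‖ ^ 2 * ∫ t, ‖slice qbar t‖ ^ 2 ∂timeMeasure +
        (ν - νb) ^ 2 / (2 * ν) * ∫ t, ‖grad Ω (ubar.val t)‖ ^ 2 ∂timeMeasure) := by
  have i1 := integrable_norm_slice_sub_sq q qbar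
  have i2 := integrable_norm_slice_sq qbar
  have i3 := ubar.integrable_norm_grad_sq
  have i12 : Integrable (fun t => 2 * ν ^ 2 * ‖B‖ ^ 2 * ‖slice q t - slice qbar t‖ ^ 2 +
      2 * (ν - νb) ^ 2 * ‖B‖ ^ 2 * ‖slice qbar t‖ ^ 2) timeMeasure :=
    (i1.const_mul _).add (i2.const_mul _)
  rw [← integral_norm_slice_sub_sq, ← integral_const_mul, ← integral_const_mul,
    ← integral_const_mul, ← integral_const_mul,
    ← integral_add (i1.const_mul _) (i2.const_mul _),
    ← integral_add i12 (i3.const_mul _)]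
  refine (u.isEvolution.sub ubar.isEvolution).integral_dissipation_le ?_
    ((u.integrable_norm_grad_sub_sq ubar).const_mul _)
    (i12.add (i3.const_mul _)) (fun t => by positivity)
    (fun t => by positivity) ?_
  · rw [hu.1, hub.1, sub_self]
  filter_upwards [hu.ae_dt_apply, hub.ae_dt_apply, u.path_ae, ubar.path_ae] with t h1 h2 h3 h4
  set w := u.val t - ubar.val t with hw
  have hwp : u.path t - ubar.path t = toL2 Ω w := by rw [hw, map_sub, h3, h4]
  rw [hwp]
  have hsplit : (u.dt t - ubar.dt t) w =
      -(ν * ‖grad Ω w‖ ^ 2) + ⟪ν • B (slice q t - slice qbar t), toL2 Ω w⟫_ℝ +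
      ⟪(ν - νb) • B (slice qbar t), toL2 Ω w⟫_ℝ - ⟪(ν - νb) • grad Ω (ubar.val t), grad Ω w⟫_ℝ := by
    have hself : lap Ω w w = -‖grad Ω w‖ ^ 2 := by
      rw [lap_apply, real_inner_self_eq_norm_sq]
    have hl : lap Ω (u.val t) w = lap Ω w w + lap Ω (ubar.val t) w := by
      rw [← sub_eq_iff_eq_add, ← lap_sub_apply]
    rw [sub_apply, h1, h2, hl, hself, lap_apply, real_inner_smul_left, real_inner_smul_left,
      real_inner_smul_left, map_sub B, inner_sub_left]
    ring
  rw [hsplit]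
  -- The weight `4`, used twice, produces exactly the `1/4 * ‖w‖ ^ 2` allowed by the energy
  -- estimate; the weight `ν⁻¹` uses up half of the dissipation `ν ‖∇w‖²`.
  have y1 := (le_abs_self _).trans (young_inner (ν • B (slice q t - slice qbar t)) (toL2 Ω w)
    (κ := 4) (by norm_num))
  have y2 := (le_abs_self _).trans (young_inner ((ν - νb) • B (slice qbar t)) (toL2 Ω w)
    (κ := 4) (by norm_num))
  have y3 := (neg_le_abs _).trans (young_inner ((ν - νb) • grad Ω (ubar.val t)) (grad Ω w)
    (κ := ν⁻¹) (inv_pos.2 hν))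
  simp only [norm_smul, Real.norm_eq_abs, mul_pow, sq_abs] at y1 y2 y3
  have b1 := mul_le_mul_of_nonneg_left (norm_control_sq_le (B := B) (slice q t - slice qbar t))
    (sq_nonneg ν)
  have b2 := mul_le_mul_of_nonneg_left (norm_control_sq_le (B := B) (slice qbar t))
    (sq_nonneg (ν - νb))
  have c1 : 1 / (2 * ν⁻¹) = ν / 2 := by field_simp
  have c2 : ν⁻¹ / 2 * ((ν - νb) ^ 2 * ‖grad Ω (ubar.val t)‖ ^ 2) =
      (ν - νb) ^ 2 / (2 * ν) * ‖grad Ω (ubar.val t)‖ ^ 2 := by field_simp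
  rw [c1, c2] at y3
  linarith

set_option maxHeartbeats 1000000 in
-- Young's inequality is weighted so that the part depending only on `z` costs at most `1/2`. What
-- remains is quadratic in the differences, and a squared `L²` distance in `Q_ad` is bounded by a
-- multiple of the `L¹` distance.
theorem FirstOrderConditions.exists_hamiltonianChange_le (hab : qa < qb)
    (hf : FirstOrderConditions B u₀ ud δ₀ qa qb νb qbar ubar μb z) :
    ∃ C, 0 ≤ C ∧ ∀ (ν : ℝ) (q : Q ρ) (u : W Ω), νb / 2 ≤ ν → ν ≤ 2 * νb → q ∈ Qad ρ qa qb →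
      IsState B u₀ ν q u →
      |hamiltonianChange B q qbar u ubar z| ≤ 1 / 2 + C * (l1Dist q qbar + (ν - νb) ^ 2) := by
  have hνb := hf.time_pos
  have hba : 0 < qb - qa := sub_pos.2 hab
  have j1 := z.integrable_norm_grad_sq
  have j2 := z.integrable_norm_toL2_sq
  set b := ‖B‖ ^ 2 with hb
  set Z := ∫ t, (‖grad Ω (z.val t)‖ ^ 2 + ‖toL2 Ω (z.val t)‖ ^ 2) ∂timeMeasure with hZ
  set N := ∫ t, ‖slice qbar t‖ ^ 2 ∂timeMeasure with hN
  set Y := ∫ t, ‖grad Ω (ubar.val t)‖ ^ 2 ∂timeMeasure with hY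
  have hb0 : 0 ≤ b := sq_nonneg _
  have hZ0 : 0 ≤ Z := integral_nonneg fun t => by positivity
  have hN0 : 0 ≤ N := integral_nonneg fun t => by positivity
  have hY0 : 0 ≤ Y := integral_nonneg fun t => by positivity
  -- The Young weight is `Z + 1`: it gives `Z / (2 (Z + 1)) ≤ 1/2` and stays positive when `Z = 0`.
  have hκ : 0 < Z + 1 := by linarith
  set C₁ := 16 * νb * b * (qb - qa) + b * (qb - qa) with hC1
  set C₂ := 16 / νb * b * N + 8 / νb ^ 2 * Y with hC2
  have hC1' : 0 ≤ C₁ := by positivity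
  have hC2' : 0 ≤ C₂ := by positivity
  refine ⟨(Z + 1) / 2 * (C₁ + C₂), by positivity, fun ν q u hν1 hν2 hq hu => ?_⟩
  have hν : 0 < ν := by linarith
  have i1 := integrable_norm_slice_sub_sq q qbar
  have i2 := u.integrable_norm_grad_sub_sq ubar
  set A := ∫ t, ‖grad Ω (u.val t - ubar.val t)‖ ^ 2 ∂timeMeasure with hA
  set D := ∫ y, (q y - qbar y) ^ 2 ∂(stMeasure ρ) with hD
  have hD0 : 0 ≤ D := integral_nonneg fun t => by positivity
  have hDL : D ≤ (qb - qa) * l1Dist q qbar := integral_sub_sq_le hq hf.control_mem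
  have hL := l1Dist_nonneg q qbar
  have hA_le : A ≤ 16 * νb * b * D + C₂ * (ν - νb) ^ 2 := by
    have h := IsState.integral_grad_sub_le hν hu hf.state
    rw [← hA, ← hD, ← hN, ← hY, ← hb] at h
    have h' : A ≤ 8 * ν * b * D + (8 / ν * b * N + 2 / ν ^ 2 * Y) * (ν - νb) ^ 2 := by
      have : A = 2 / ν * (ν / 2 * A) := by field_simp
      rw [this]
      refine (mul_le_mul_of_nonneg_left h (by positivity)).trans_eq ?_
      field_simp
      ring
    have t1 : 8 / ν ≤ 16 / νb := by
      rw [div_le_div_iff₀ hν hνb]; linarith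
    have t2 : 2 / ν ^ 2 ≤ 8 / νb ^ 2 := by
      rw [div_le_div_iff₀ (by positivity) (by positivity)]; nlinarith
    have t3 : 8 * ν ≤ 16 * νb := by linarith
    refine h'.trans ?_
    rw [hC2]
    gcongr
  have hmain : |hamiltonianChange B q qbar u ubar z| ≤ (Z + 1) / 2 * (A + b * D) + 1 / 2 := by
    have i12 : Integrable (fun t => (Z + 1) / 2 * (‖grad Ω (u.val t - ubar.val t)‖ ^ 2 +
        b * ‖slice q t - slice qbar t‖ ^ 2)) timeMeasure := (i2.add (i1.const_mul _)).const_mul _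
    have j12 : Integrable (fun t => 1 / (2 * (Z + 1)) * (‖grad Ω (z.val t)‖ ^ 2 +
        ‖toL2 Ω (z.val t)‖ ^ 2)) timeMeasure := (j1.add j2).const_mul _
    have hle : |hamiltonianChange B q qbar u ubar z| ≤
        ∫ t, ((Z + 1) / 2 * (‖grad Ω (u.val t - ubar.val t)‖ ^ 2 +
          b * ‖slice q t - slice qbar t‖ ^ 2) + 1 / (2 * (Z + 1)) *
          (‖grad Ω (z.val t)‖ ^ 2 + ‖toL2 Ω (z.val t)‖ ^ 2)) ∂timeMeasure := by
      rw [hamiltonianChange, ← Real.norm_eq_abs]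
      refine norm_integral_le_of_norm_le (i12.add j12) (Eventually.of_forall fun t => ?_)
      rw [Real.norm_eq_abs, lap_apply]
      refine (abs_add_le _ _).trans ?_
      rw [abs_neg]
      have y1 := young_inner (grad Ω (u.val t - ubar.val t)) (grad Ω (z.val t)) hκ
      have y2 := young_inner (B (slice q t - slice qbar t)) (toL2 Ω (z.val t)) hκ
      have y3 := mul_le_mul_of_nonneg_left
        (norm_control_sq_le (B := B) (slice q t - slice qbar t)) (half_pos hκ).le
      rw [← hb] at y3
      linarith
    rw [integral_add i12 j12, integral_const_mul, integral_const_mul,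
      integral_add i2 (i1.const_mul _), integral_const_mul, integral_norm_slice_sub_sq,
      ← hA, ← hD, ← hZ] at hle
    have : 1 / (2 * (Z + 1)) * Z ≤ 1 / 2 := by
      rw [div_mul_eq_mul_div, div_le_div_iff₀ (by positivity) (by norm_num)]; linarith
    linarith
  have hAD : A + b * D ≤ (C₁ + C₂) * (l1Dist q qbar + (ν - νb) ^ 2) := by
    have h1 : 16 * νb * b * D ≤ 16 * νb * b * ((qb - qa) * l1Dist q qbar) := by gcongr
    have h2 : b * D ≤ b * ((qb - qa) * l1Dist q qbar) := by gcongr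
    have h3 : A + b * D ≤ C₁ * l1Dist q qbar + C₂ * (ν - νb) ^ 2 := by
      rw [hC1]; linarith
    nlinarith [mul_nonneg hC1' (sq_nonneg (ν - νb)), mul_nonneg hC2' hL]
  have := mul_le_mul_of_nonneg_left hAD (half_pos hκ).le
  linarith

end Equation

/-! ### Absorption and local growth. -/

section Main

variable {d : ℕ} {Ω : Set (Sp d)} {X : Type} [MeasurableSpace X] {ρ : Measure X}
  {B : Lp ℝ 2 ρ →L[ℝ] L2 Ω} {u₀ ud : H10 Ω} {νb δ₀ qa qb μb : ℝ} {qbar : Q ρ} {ubar z : W Ω}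

/-- Finiteness bounds `Q_ad` in `L¹(I × ω)`, which replaces a restriction on the competing controls.
-/
theorem IsControlOperator.isFiniteMeasure (hΩ : IsConvexPolytopalDomain Ω)
    (hB : IsControlOperator Ω X ρ B) : IsFiniteMeasure ρ := by
  cases hB with
  | distributed ω hω hsub B hB =>
    obtain ⟨-, s, hs⟩ := hΩ
    have hbd : Bornology.IsBounded ω := by
      refine Bornology.IsBounded.subset ?_ (hsub.trans (hs.trans_subset interior_subset))
      exact isBounded_convexHull.2 s.finite_toSet.isBounded
    exact ⟨by rw [Measure.restrict_apply_univ]; exact hbd.measure_lt_top⟩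
  | timeDependent N e B hB => infer_instance

/-- A scalar absorption argument: the growth inequality with a perturbed factor `1 - E` forces
`L` to be small when `x` is, and then `1 - E` can be replaced by a constant. -/
theorem exists_growth_constant {θ : ℝ → ℝ} (hmono : ∀ x y, 0 ≤ x → x ≤ y → θ x ≤ θ y)
    (hpos : ∀ x, 0 < x → 0 < θ x) {C R ν : ℝ} (hC : 0 ≤ C) (hR : 0 ≤ R) (hν : 0 < ν) :
    ∃ δ > 0, ∀ x E L : ℝ, |x| ≤ δ → 0 ≤ L → L ≤ R → |E| ≤ 1 / 2 + C * (L + x ^ 2) →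
      ν * (1 / 2 * θ L * L) ≤ x * (1 - E) →
      0 ≤ ν * (1 / 2 * θ L * L) ∧ ν * (1 / 2 * θ L * L) ≤ 2 * x := by
  -- Chosen so that `L, x² ≤ η` gives `C (L + x²) ≤ 1/4`, hence `|E| ≤ 3/4`.
  set η := 1 / (8 * (C + 1)) with hη
  have hη0 : 0 < η := by positivity
  have hCη : C * η ≤ 1 / 8 := by
    rw [hη, mul_one_div, div_le_div_iff₀ (by positivity) (by norm_num)]; linarith
  have hη1 : η ≤ 1 := by
    rw [hη, div_le_one (by positivity)]; linarith
  set K := 3 / 2 + C * (R + 1) with hK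
  have hK0 : 0 < K := by positivity
  have hθη := hpos η hη0
  -- `K` bounds `|1 - E|` for every `L ≤ R`. If `L > η`, the left side would be at least `ν θ(η) η /
  -- 2`, while this bound on `|x|` keeps the right side below `ν θ(η) η / 4`.
  refine ⟨min η (ν * θ η * η / (4 * K)), by positivity, fun x E L hx hL hLR hE hgr => ?_⟩
  have hx1 : |x| ≤ η := hx.trans (min_le_left _ _)
  have hx2 : |x| ≤ ν * θ η * η / (4 * K) := hx.trans (min_le_right _ _)
  have hxsq : x ^ 2 ≤ η := by
    rw [← sq_abs]; nlinarith [abs_nonneg x]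
  have hE' := abs_le.1 hE
  have hnn : 0 ≤ ν * (1 / 2 * θ L * L) := by
    rcases hL.eq_or_lt with h | h
    · rw [← h, mul_zero, mul_zero]
    · have := hpos L h
      positivity
  have hLη : L ≤ η := by
    by_contra hlt
    have hlt := not_le.1 hlt
    have h1 : ν * (1 / 2 * θ η * η) ≤ ν * (1 / 2 * θ L * L) := by
      have hθ := hmono η L hη0.le hlt.le
      have hθL := hpos L (hη0.trans hlt)
      gcongr
    have h2 : |1 - E| ≤ K := by
      have : C * (L + x ^ 2) ≤ C * (R + 1) := by gcongr; exact hxsq.trans hη1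
      rw [abs_le]; constructor <;> linarith [hE'.1, hE'.2]
    have h3 : x * (1 - E) ≤ ν * θ η * η / (4 * K) * K :=
      (le_abs_self _).trans (by rw [abs_mul]; gcongr)
    have h4 : ν * θ η * η / (4 * K) * K = ν * θ η * η / 4 := by field_simp
    have h5 : 0 < ν * θ η * η := by positivity
    linarith
  have hsmall : C * (L + x ^ 2) ≤ 1 / 4 := by
    have : C * (L + x ^ 2) ≤ C * (η + η) := by gcongr
    linarith
  -- Since `1 - E ≥ 1/4` and the left side is nonnegative, `x` cannot be negative.
  have hx0 : 0 ≤ x := by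
    by_contra hneg
    nlinarith [hE'.2, not_le.1 hneg]
  refine ⟨hnn, hgr.trans ?_⟩
  nlinarith [hE'.1]

theorem FirstOrderConditions.exists_growth [IsFiniteMeasure ρ] (hab : qa < qb)
    (hf : FirstOrderConditions B u₀ ud δ₀ qa qb νb qbar ubar μb z)
    {p : Q ρ} (hp : IsObservation B z p) (hnodal : stMeasure ρ {y | p y = 0} = 0)
    {Ψ : ℝ → ℝ} (hΨ : IsStructuralFunction p Ψ) :
    ∃ δ > 0, ∀ (ν : ℝ) (q : Q ρ), Admissible B u₀ ud δ₀ qa qb ν q → |ν - νb| ≤ δ →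
      0 ≤ νb / 6 * psiInv Ψ ((2 * (qb - qa))⁻¹ * l1Dist q qbar) * l1Dist q qbar ∧
      νb / 6 * psiInv Ψ ((2 * (qb - qa))⁻¹ * l1Dist q qbar) * l1Dist q qbar ≤ ν - νb := by
  have hba : 0 < qb - qa := sub_pos.2 hab
  have hνb := hf.time_pos
  have hvar : ∀ q ∈ Qad ρ qa qb, 0 ≤ ∫ y, p y * (q y - qbar y) ∂(stMeasure ρ) := fun q hq => by
    rw [← hp.integral_eq]; exact hf.variational q hq
  obtain ⟨C, hC, hCE⟩ := hf.exists_hamiltonianChange_le hab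
  obtain ⟨δ, hδ, hgr⟩ := exists_growth_constant (θ := fun L => psiInv Ψ ((2 * (qb - qa))⁻¹ * L))
    (fun x y hx hxy => hΨ.psiInv_mono (by positivity) (by gcongr))
    (fun x hx => hΨ.psiInv_pos (by positivity)) hC
    (R := (stMeasure ρ).real univ * (qb - qa)) (by positivity) hνb
  -- The bound `νb / 2` keeps `ν` comparable with `νb`, as the estimate of the Hamiltonian change
  -- requires.
  refine ⟨min δ (νb / 2), by positivity, fun ν q ⟨hν, hq, u, hu, hG⟩ hδν => ?_⟩
  have hν2 := abs_le.1 (hδν.trans (min_le_right _ _))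
  have hE := hCE ν q u (by linarith [hν2.1]) (by linarith [hν2.2]) hq hu
  have hle := hf.growth_le hν hu hG
  rw [hp.integral_eq] at hle
  have hg := hΨ.growth hab hnodal hf.control_mem hvar hq
  obtain ⟨h1, h2⟩ := hgr (ν - νb) _ _ (hδν.trans (min_le_left _ _)) (l1Dist_nonneg q qbar)
    (l1Dist_le hq hf.control_mem) hE ((mul_le_mul_of_nonneg_left hg hνb.le).trans hle)
  -- The absorption yields the factor `νb / 4`, which is stronger than `νb / 6` because the
  -- expression is nonnegative.
  constructor <;> linarith

end Main

end TimeOptimal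

end

theorem mainTheorem1
    {d : ℕ} (hd : d = 2 ∨ d = 3)
    (Ω : Set (TimeOptimal.Sp d)) (hΩ : TimeOptimal.IsConvexPolytopalDomain Ω)
    {X : Type} [MeasurableSpace X] (ρ : Measure X)
    (B : Lp ℝ 2 ρ →L[ℝ] TimeOptimal.L2 Ω) (hB : TimeOptimal.IsControlOperator Ω X ρ B)
    (u₀ ud : TimeOptimal.H10 Ω) (δ₀ : ℝ) (hδ₀ : 0 < δ₀)
    (qa qb : ℝ) (hab : qa < qb)
    (νbar : ℝ) (qbar : TimeOptimal.Q ρ) (ubar : TimeOptimal.W Ω)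
    (μbar : ℝ) (zbar : TimeOptimal.W Ω)
    (hfirst : TimeOptimal.FirstOrderConditions B u₀ ud δ₀ qa qb νbar qbar ubar μbar zbar)
    -- `p` is the function `B*z̄` on `I × ω`
    (p : TimeOptimal.Q ρ) (hp : TimeOptimal.IsObservation B zbar p)
    (hnodal : TimeOptimal.stMeasure ρ {y | p y = 0} = 0) :
    TimeOptimal.IsLocallyOptimal B u₀ ud δ₀ qa qb νbar qbar ∧
    (∃ Ψ : ℝ → ℝ, TimeOptimal.IsStructuralFunction p Ψ) ∧
    ∀ Ψ : ℝ → ℝ, TimeOptimal.IsStructuralFunction p Ψ →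
      ∃ δ > 0, ∀ (ν : ℝ) (q : TimeOptimal.Q ρ),
        TimeOptimal.Admissible B u₀ ud δ₀ qa qb ν q → |ν - νbar| ≤ δ →
        νbar / 6 * TimeOptimal.psiInv Ψ ((2 * (qb - qa))⁻¹ * TimeOptimal.l1Dist q qbar) *
          TimeOptimal.l1Dist q qbar ≤ ν - νbar := by
  have := hB.isFiniteMeasure hΩ
  obtain ⟨Ψ₀, hΨ₀⟩ := TimeOptimal.exists_isStructuralFunction p hnodal
  refine ⟨⟨⟨hfirst.time_pos, hfirst.control_mem, ubar, hfirst.state, hfirst.terminal.le⟩, ?_⟩,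
    ⟨Ψ₀, hΨ₀⟩, fun Ψ hΨ => ?_⟩
  -- Local optimality needs only that the lower bound for `ν - νbar` is nonnegative, for any one
  -- structural function.
  · obtain ⟨δ, hδ, h⟩ := hfirst.exists_growth hab hp hnodal hΨ₀
    refine ⟨δ, hδ, fun ν q hq hν => ?_⟩
    obtain ⟨h1, h2⟩ := h ν q hq hν
    linarith
  · obtain ⟨δ, hδ, h⟩ := hfirst.exists_growth hab hp hnodal hΨ
    exact ⟨δ, hδ, fun ν q hq hν => (h ν q hq hν).2⟩
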